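/- Let $M$ be an $n$-dimensional complex manifold (Hausdorff, second countable), and let $X,Z\subset M$ be closed subsets such that: $X$ is locally negligible with respect to $L^2$ holomorphic functions (for every coordinate neighbourhood $U$, every $L^2$ holomorphic function on $U\setminus X$ extends to an $L^2$ holomorphic function on $U$ with the same $L^2$ norm), $Z$ is an analytic subset of $M$, and $M\setminus(X\cup Z)$ is a weakly pseudoconvex Kähler manifold. Plurisubharmonic functions are not identically $-\infty$ on any connected component. Let $T\in[-\infty,+\infty)$, let $\psi<-T$ and $\tilde\psi<-T$ be plurisubharmonic functions on $M$, and let $\varphi,\tilde\varphi$ be Lebesgue measurable functions on $M$ such that $\varphi+\psi$ and $\tilde\varphi+\tilde\psi$ are plurisubharmonic. A positive measurable function $c$ on $(T,+\infty)$ is in $\mathcal P_{T,M,\varphi,\psi}$ if $c(t)e^{-t}$ is decreasing (not necessarily strictly) and there is a closed set $E\subset Z\cap\{\psi=-\infty\}$ such that $e^{-\varphi}c(-\psi)$ has a positive lower bound on every compact subset of $M\setminus E$. Write $\mathcal I(u)$ for the multiplier ideal sheaf of $u$. Let $Z_0,\tilde Z_0\subset M$ satisfy $Z_0\cap\operatorname{Supp}(\mathcal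 O/\mathcal I(\varphi+\psi))\ne\emptyset$ and $\tilde Z_0\cap\operatorname{Supp}(\mathcal O/\mathcal I(\tilde\varphi+\tilde\psi))\ne\emptyset$. Let $f$ be a holomorphic $(n,0)$ form on an open set containing $Z_0$. For $z\in Z_0$ (resp. $z\in\tilde Z_0$) let $\mathcal F_z\supset\mathcal I(\varphi+\psi)_z$ (resp. $\tilde{\mathcal F}_z\supset\mathcal I(\tilde\varphi+\tilde\psi)_z$) be an ideal of $\mathcal O_z$. A holomorphic $(n,0)$ form $F$ on $\{\psi<-t\}$ is called admissible for $(t;\psi,Z_0,\mathcal F)$ if $Z_0\subset\{\psi<-t\}$ and $(F-f,z)\in(\mathcal O(K_M)\otimes\mathcal F)_z$ for all $z\in Z_0$. Put $$G(t;\varphi,\psi,c)=\inf\Big\{\int_{\{\psi<-t\}}|F|^2e^{-\varphi}c(-\psi)\Big\}\in[0,+\infty],\qquad |F|^2=\sqrt{-1}^{\,n^2}F\wedge\bar F,$$ the infimum being over all admissible $F$ (and $+\infty$ if there are none), and let $\mathcal H^2(c,t,\varphi,\psi)$ be the set of admissible $F$ for which this integral is finite. Define $G(t;\tilde\varphi,\tilde\psi,\tilde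 c)$ and $\mathcal H^2(\tilde c,t,\tilde\varphi,\tilde\psi)$ in the same way from $\tilde\varphi,\tilde\psi,\tilde c,\tilde Z_0,\tilde{\mathcal F}$ and the same $f$. Let $T\le T_1<T_2<+\infty$ with $T_1,T_2\in\mathbb R$, let $c\in\mathcal P_{T,M,\varphi,\psi}$ and $\tilde c\in\mathcal P_{T,M,\tilde\varphi,\tilde\psi}$ with $\int_{T_2}^{+\infty}c(t)e^{-t}dt<+\infty$ and $\int_{T_2}^{+\infty}\tilde c(t)e^{-t}dt<+\infty$, and put $h(t)=\int_t^{+\infty}c(s)e^{-s}ds$, $\tilde h(t)=\int_t^{+\infty}\tilde c(s)e^{-s}ds$. Assume: (1) $\tilde\psi<-T_1$ on $\{\psi<-T_1\}$ and $\tilde\psi<-T_2$ on $\{\psi<-T_2\}$; (2) $\tilde\psi=\psi$ and $\tilde\varphi=\varphi$ on $\{-T_2\le\psi<-T_1\}$; (3) $\tilde Z_0=Z_0$, and $\mathcal I(\tilde\varphi+\tilde\psi)_z\subset\mathcal I(\varphi+\psi)_z$ and $\mathcal F_z\subset\tilde{\mathcal F}_z$ for all $z\in Z_0$; (4) for every $t\in[T_1,T_2]$,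 $\mathcal H^2(c,t,\varphi,\psi)\subset\mathcal H^2(\tilde c,t,\tilde\varphi,\tilde\psi)$, in the sense that every element of the former is the restriction to $\{\psi<-t\}$ of an element of the latter. Suppose that $G(\tilde h^{-1}(r);\tilde\varphi,\tilde\psi,\tilde c)$ is linear (i.e. finite and affine) in $r\in[\tilde h(T_2),\tilde h(T_1)]$, and let $\tilde F$ be a holomorphic $(n,0)$ form on $\{\tilde\psi<-T_1\}$, admissible for $(T_1;\tilde\psi,\tilde Z_0,\tilde{\mathcal F})$, with $$\int_{\{\tilde\psi<-t\}}|\tilde F|^2e^{-\tilde\varphi}\tilde c(-\tilde\psi)=G(t;\tilde\varphi,\tilde\psi,\tilde c)\quad\text{for all }t\in[T_1,T_2].$$ Suppose moreover that $\tilde F$ minimizes $G(T_2;\varphi,\psi,c)$, i.e. $\tilde F|_{\{\psi<-T_2\}}$ is admissible for $(T_2;\psi,Z_0,\mathcal F)$ and $$\int_{\{\psi<-T_2\}}|\tilde F|^2e^{-\varphi}c(-\psi)=G(T_2;\varphi,\psi,c)<+\infty.$$ Then $G(h^{-1}(r);\varphi,\psi,c)$ is linear (finite and affine) in $r\in[h(T_2),h(T_1)]$.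 (If $h(T_1)=+\infty$ or $\tilde h(T_1)=+\infty$, the corresponding interval is understood as $[h(T_2),+\infty)$, resp. $[\tilde h(T_2),+\infty)$.) -/

import Mathlib

open Set Filter Topology MeasureTheory Manifold
open scoped ENNReal ContDiff

namespace MinimalL2

noncomputable section

/-- The model space `ℂⁿ`.  Its canonical measure `volume` is Lebesgue measure on `ℂⁿ = ℝ²ⁿ`. -/
abbrev Cn (n : ℕ) : Type := Fin n → ℂ

/-! ### Holomorphic germs, plurisubharmonic functions, analytic sets -/

section Manifold

variable {n : ℕ} {M : Type*} [TopologicalSpace M] [ChartedSpace (Cn n) M]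

/-- `g` is a holomorphic function on a neighbourhood of `z`. -/
def HolomorphicNear (n : ℕ) {M : Type*} [TopologicalSpace M] [ChartedSpace (Cn n) M]
    (g : M → ℂ) (z : M) : Prop :=
  ∀ᶠ x in 𝓝 z, MDifferentiableAt 𝓘(ℂ, Cn n) 𝓘(ℂ, ℂ) g x

/-- The ring `𝒪_{M,z}` of germs at `z` of holomorphic functions. -/
def HoloGerm (n : ℕ) {M : Type*} [TopologicalSpace M] [ChartedSpace (Cn n) M] (z : M) :
    Subring (Germ (𝓝 z) ℂ) where
  carrier := {γ | ∃ g : M → ℂ, HolomorphicNear n g z ∧ (g : Germ (𝓝 z) ℂ) = γ}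
  mul_mem' := by
    rintro _ _ ⟨g, hg, rfl⟩ ⟨h, hh, rfl⟩
    refine ⟨g * h, ?_, rfl⟩
    filter_upwards [hg, hh] with x h1 h2 using h1.mul h2
  one_mem' := ⟨fun _ => 1, Eventually.of_forall fun _ => mdifferentiableAt_const, rfl⟩
  add_mem' := by
    rintro _ _ ⟨g, hg, rfl⟩ ⟨h, hh, rfl⟩
    refine ⟨g + h, ?_, rfl⟩
    filter_upwards [hg, hh] with x h1 h2 using h1.add h2
  zero_mem' := ⟨fun _ => 0, Eventually.of_forall fun _ => mdifferentiableAt_const, rfl⟩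
  neg_mem' := by
    rintro _ ⟨g, hg, rfl⟩
    refine ⟨-g, ?_, rfl⟩
    filter_upwards [hg] with x h1 using h1.neg

/-- `u : M → [-∞, +∞)` is plurisubharmonic on the open set `Ω`: it is upper semicontinuous, not
identically `-∞` on any nonempty open subset of `Ω` (equivalently, on any connected component), and
satisfies the sub-mean value inequality on every closed complex disc `{y + ζ v : |ζ| ≤ 1}` of a
coordinate chart.  The inequality `u(y) ≤ (2π)⁻¹ ∫ u(y + e^{iθ} v) dθ` between elements of
`[-∞, +∞)` is written, for the upper bounds `C` of `u` on the disc, as the inequality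
`∫ (C - u(y + e^{iθ} v)) dθ ≤ 2π (C - u(y))` between elements of `[0, +∞]`. -/
def IsPSHOn (n : ℕ) {M : Type*} [TopologicalSpace M] [ChartedSpace (Cn n) M]
    (u : M → EReal) (Ω : Set M) : Prop :=
  (∀ x ∈ Ω, u x ≠ ⊤) ∧
  UpperSemicontinuousOn u Ω ∧
  (∀ V : Set M, IsOpen V → V.Nonempty → V ⊆ Ω → ∃ x ∈ V, u x ≠ ⊥) ∧
  ∀ e ∈ atlas (Cn n) M, ∀ y v : Cn n,
    (∀ ζ : ℂ, ‖ζ‖ ≤ 1 → y + ζ • v ∈ e.target ∧ e.symm (y + ζ • v) ∈ Ω) →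
    ∀ C : ℝ, (∀ ζ : ℂ, ‖ζ‖ ≤ 1 → u (e.symm (y + ζ • v)) ≤ (C : EReal)) →
      (∫⁻ θ in Ioc (0 : ℝ) (2 * Real.pi),
          ((C : EReal) - u (e.symm (y + Complex.exp (θ * Complex.I) • v))).toENNReal)
        ≤ ENNReal.ofReal (2 * Real.pi) * ((C : EReal) - u (e.symm y)).toENNReal

/-- `φ` is Lebesgue measurable (in local coordinates). -/
def LebesgueMeasurable (n : ℕ) {M : Type*} [TopologicalSpace M] [ChartedSpace (Cn n) M]
    (φ : M → EReal) : Prop :=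
  ∀ e ∈ atlas (Cn n) M, AEMeasurable (fun y => φ (e.symm y)) (volume.restrict e.target)

/-- `φ + ψ` is a plurisubharmonic function on `M`.  The sum is defined pointwise off the
pluripolar set `{ψ = -∞}` (for `ψ < +∞`); on that set of measure zero, where it may be of the form
`∞ - ∞`, the value is the one of the plurisubharmonic function. -/
def SumIsPSH (n : ℕ) {M : Type*} [TopologicalSpace M] [ChartedSpace (Cn n) M]
    (φ ψ : M → EReal) : Prop :=
  ∃ Φ : M → EReal, IsPSHOn n Φ univ ∧ ∀ x, ψ x ≠ ⊥ → φ x + ψ x = Φ x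

/-- The stalk `𝓘(u)_z` of the multiplier ideal sheaf of `u`: germs `g` with `|g|² e^{-u}` integrable
on a neighbourhood of `z` with respect to Lebesgue measure in local coordinates. -/
def multiplierIdeal (n : ℕ) {M : Type*} [TopologicalSpace M] [ChartedSpace (Cn n) M]
    (u : M → EReal) (z : M) : Set (HoloGerm n z) :=
  {γ | ∃ g : M → ℂ, (g : Germ (𝓝 z) ℂ) = (γ : Germ (𝓝 z) ℂ) ∧ ∃ W ∈ 𝓝 z,
    ∫⁻ y in (chartAt (Cn n) z).target ∩ (chartAt (Cn n) z).symm ⁻¹' W,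
      ‖g ((chartAt (Cn n) z).symm y)‖ₑ ^ 2 * EReal.exp (-(u ((chartAt (Cn n) z).symm y))) < ⊤}

/-- The support of the sheaf `𝒪 / 𝓘(u)`: the points `z` with `𝓘(u)_z ≠ 𝒪_z`. -/
def cosupport (n : ℕ) {M : Type*} [TopologicalSpace M] [ChartedSpace (Cn n) M]
    (u : M → EReal) : Set M :=
  {z | multiplierIdeal n u z ≠ univ}

/-- `Z` is an analytic subset of `M`: near every point of `M` it is the common zero set of finitely
many holomorphic functions. -/
def IsAnalyticSubset (n : ℕ) {M : Type*} [TopologicalSpace M] [ChartedSpace (Cn n) M]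
    (Z : Set M) : Prop :=
  ∀ x : M, ∃ W : Set M, IsOpen W ∧ x ∈ W ∧ ∃ (k : ℕ) (g : Fin k → M → ℂ),
    (∀ i, MDifferentiableOn 𝓘(ℂ, Cn n) 𝓘(ℂ, ℂ) (g i) W) ∧
    Z ∩ W = {y ∈ W | ∀ i, g i y = 0}

/-- The closed set `X` is locally negligible with respect to `L²` holomorphic functions: on every
coordinate neighbourhood `U`, every `L²` holomorphic function on `U \ X` is the restriction of an
`L²` holomorphic function on `U` with the same `L²` norm. -/
def IsLocallyNegligible (n : ℕ) {M : Type*} [TopologicalSpace M] [ChartedSpace (Cn n) M]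
    (X : Set M) : Prop :=
  ∀ e ∈ IsManifold.maximalAtlas 𝓘(ℂ, Cn n) ω M, ∀ g : Cn n → ℂ,
    DifferentiableOn ℂ g (e.target \ e.symm ⁻¹' X) →
    ∫⁻ y in e.target \ e.symm ⁻¹' X, ‖g y‖ₑ ^ 2 < ⊤ →
    ∃ g' : Cn n → ℂ, DifferentiableOn ℂ g' e.target ∧
      EqOn g' g (e.target \ e.symm ⁻¹' X) ∧
      ∫⁻ y in e.target, ‖g' y‖ₑ ^ 2 = ∫⁻ y in e.target \ e.symm ⁻¹' X, ‖g y‖ₑ ^ 2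

/-- The expression, in the chart `e`, of a real differential 2-form on `M`. -/
def localTwoForm (e : OpenPartialHomeomorph M (Cn n))
    (η : (x : M) → (TangentSpace 𝓘(ℂ, Cn n) x) [⋀^Fin 2]→L[ℝ] ℝ) (y : Cn n) :
    (Cn n) [⋀^Fin 2]→L[ℝ] ℝ :=
  (η (e.symm y)).compContinuousLinearMap
    ((mfderiv 𝓘(ℂ, Cn n) 𝓘(ℂ, Cn n) e.symm y).restrictScalars ℝ)

/-- The open set `Ω` carries a Kähler metric, given by its fundamental form: a smooth, closed,
positive real 2-form of type `(1,1)`. -/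
def IsKahlerOn (n : ℕ) {M : Type*} [TopologicalSpace M] [ChartedSpace (Cn n) M]
    (Ω : Set M) : Prop :=
  ∃ η : (x : M) → (TangentSpace 𝓘(ℂ, Cn n) x) [⋀^Fin 2]→L[ℝ] ℝ,
    (∀ x ∈ Ω, ∀ v w : TangentSpace 𝓘(ℂ, Cn n) x,
      η x ![Complex.I • v, Complex.I • w] = η x ![v, w]) ∧
    (∀ x ∈ Ω, ∀ v : TangentSpace 𝓘(ℂ, Cn n) x, v ≠ 0 → 0 < η x ![v, Complex.I • v]) ∧
    ∀ e ∈ atlas (Cn n) M,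
      ContDiffOn ℝ ∞ (localTwoForm e η) (e.target ∩ e.symm ⁻¹' Ω) ∧
      ∀ y ∈ e.target ∩ e.symm ⁻¹' Ω, extDeriv (localTwoForm e η) y = 0

/-- The open set `Ω` is weakly pseudoconvex: it has a smooth plurisubharmonic exhaustion. -/
def IsWeaklyPseudoconvexOn (n : ℕ) {M : Type*} [TopologicalSpace M] [ChartedSpace (Cn n) M]
    (Ω : Set M) : Prop :=
  ∃ ρ : M → ℝ, ContMDiffOn 𝓘(ℝ, Cn n) 𝓘(ℝ, ℝ) ∞ ρ Ω ∧
    IsPSHOn n (fun x => (ρ x : EReal)) Ω ∧ ∀ a : ℝ, IsCompact {x ∈ Ω | ρ x ≤ a}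

/-- Condition `(A)` for the triple `(M, X, Z)`. -/
structure ConditionA (n : ℕ) {M : Type*} [TopologicalSpace M] [ChartedSpace (Cn n) M]
    (X Z : Set M) : Prop where
  isClosed_X : IsClosed X
  isClosed_Z : IsClosed Z
  negligible_X : IsLocallyNegligible n X
  analytic_Z : IsAnalyticSubset n Z
  weaklyPseudoconvex : IsWeaklyPseudoconvexOn n (X ∪ Z)ᶜ
  kahler : IsKahlerOn n (X ∪ Z)ᶜ

/-! ### Gains -/

/-- The weight `e^{-φ} c(-ψ)`. -/
def weight {M : Type*} (φ ψ : M → EReal) (c : ℝ → ℝ) (x : M) : ℝ≥0∞ :=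
  EReal.exp (-(φ x)) * ENNReal.ofReal (c (-(ψ x)).toReal)

/-- The class `𝒫_{T,M,φ,ψ}` of gains: positive measurable functions `c` on `(T, +∞)` such that
`c(t) e^{-t}` is decreasing and, for some closed `E ⊆ Z ∩ {ψ = -∞}`, the function `e^{-φ} c(-ψ)`
(defined where `ψ ≠ -∞`) has a positive lower bound on each compact subset of `M \ E`. -/
structure IsGain {M : Type*} [TopologicalSpace M] (Z : Set M) (T : EReal) (φ ψ : M → EReal)
    (c : ℝ → ℝ) : Prop where
  pos : ∀ t : ℝ, T < (t : EReal) → 0 < c t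
  measurable : AEMeasurable c (volume.restrict {t : ℝ | T < (t : EReal)})
  antitone : AntitoneOn (fun t : ℝ => c t * Real.exp (-t)) {t : ℝ | T < (t : EReal)}
  lower_bound : ∃ E : Set M, IsClosed E ∧ E ⊆ Z ∩ {x | ψ x = ⊥} ∧
    ∀ K : Set M, IsCompact K → K ⊆ Eᶜ →
      ∃ δ : ℝ≥0∞, 0 < δ ∧ ∀ x ∈ K, ψ x ≠ ⊥ → δ ≤ weight φ ψ c x

/-- `h(t) = ∫_t^{+∞} c(s) e^{-s} ds`, with values in `[0, +∞]`. -/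
def gainTail (c : ℝ → ℝ) (t : ℝ) : ℝ≥0∞ :=
  ∫⁻ s in Ioi t, ENNReal.ofReal (c s * Real.exp (-s))

/-! ### Holomorphic `(n,0)`-forms and their integrals -/

/-- `(n,0)`-forms: sections of the canonical bundle of complex-multilinear alternating `n`-forms on
the tangent spaces.  A form on a subset is a form considered on that subset only. -/
abbrev NForm (n : ℕ) (M : Type*) [TopologicalSpace M] [ChartedSpace (Cn n) M] : Type _ :=
  (x : M) → (TangentSpace 𝓘(ℂ, Cn n) x) [⋀^Fin n]→L[ℂ] ℂ

/-- The coefficient `a` of `F = a dw₁ ∧ ⋯ ∧ dwₙ` in the chart `e = (w₁, …, wₙ)`: the value of `F` on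
the coordinate frame `∂/∂w₁, …, ∂/∂wₙ`. -/
def NForm.coeff (F : NForm n M) (e : OpenPartialHomeomorph M (Cn n)) (x : M) : ℂ :=
  F x (fun i => mfderiv 𝓘(ℂ, Cn n) 𝓘(ℂ, Cn n) e.symm (e x) (Pi.single i (1 : ℂ) : Cn n))

/-- `F` is holomorphic on the open set `Ω`: so are its coefficients in all charts. -/
def NForm.HolomorphicOn (F : NForm n M) (Ω : Set M) : Prop :=
  ∀ e ∈ atlas (Cn n) M,
    DifferentiableOn ℂ (fun y => F.coeff e (e.symm y)) (e.target ∩ e.symm ⁻¹' Ω)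

/-- A second countable manifold is cut into countably many disjoint Borel pieces, each contained in
a chart: `κ x` is the centre of the chart used for the piece containing `x`. -/
theorem exists_chartSelector (n : ℕ) (M : Type*) [TopologicalSpace M] [ChartedSpace (Cn n) M]
    [SecondCountableTopology M] :
    ∃ κ : M → M, (∀ x, x ∈ (chartAt (Cn n) (κ x)).source) ∧ (range κ).Countable ∧
      ∀ p, MeasurableSet[borel M] (κ ⁻¹' {p}) := by
  classical
  obtain ⟨s, hs, hcov⟩ := TopologicalSpace.countable_cover_nhds
    (fun x : M => chart_source_mem_nhds (Cn n) x)
  rcases isEmpty_or_nonempty M with hM | hM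
  · exact ⟨id, fun x => (hM.false x).elim, (Set.toFinite _).countable,
      fun p => (hM.false p).elim⟩
  have hne : s.Nonempty := by
    by_contra h
    rw [not_nonempty_iff_eq_empty] at h
    subst h
    obtain ⟨x⟩ := hM
    have : x ∈ (univ : Set M) := mem_univ x
    rw [← hcov] at this
    simp at this
  obtain ⟨p, hp⟩ := hs.exists_eq_range hne
  have hex : ∀ x, ∃ k, x ∈ (chartAt (Cn n) (p k)).source := by
    intro x
    have hx : x ∈ (univ : Set M) := mem_univ x
    rw [← hcov, hp] at hx
    simpa using hx
  refine ⟨fun x => p (Nat.find (hex x)), fun x => Nat.find_spec (hex x), ?_, fun q => ?_⟩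
  · exact (countable_range p).mono (by rintro _ ⟨x, rfl⟩; exact mem_range_self _)
  · borelize M
    have hpre : (fun x => p (Nat.find (hex x))) ⁻¹' {q} =
        ⋃ k ∈ {k | p k = q}, ((chartAt (Cn n) (p k)).source \
          ⋃ j ∈ {j | j < k}, (chartAt (Cn n) (p j)).source) := by
      ext x
      simp only [mem_preimage, mem_singleton_iff, mem_iUnion, mem_ofPred_eq, Set.mem_sdiff,
        exists_prop, not_exists, not_and]
      constructor
      · intro h
        exact ⟨_, h, Nat.find_spec (hex x), fun j hj => Nat.find_min (hex x) hj⟩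
      · rintro ⟨k, hk, hxk, hmin⟩
        have : Nat.find (hex x) = k := (Nat.find_eq_iff (hex x)).2 ⟨hxk, hmin⟩
        rw [this, hk]
    rw [hpre]
    exact MeasurableSet.biUnion (to_countable _) fun k _ =>
      (chartAt (Cn n) (p k)).open_source.measurableSet.diff
        (MeasurableSet.biUnion (to_countable _) fun j _ =>
          (chartAt (Cn n) (p j)).open_source.measurableSet)

/-- A choice of chart centres as in `exists_chartSelector`. -/
def chartSelector (n : ℕ) (M : Type*) [TopologicalSpace M] [ChartedSpace (Cn n) M]
    [SecondCountableTopology M] : M → M :=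
  (exists_chartSelector n M).choose

/-- The integral `∫_S |F|² w`, where `|F|² = (√-1)^{n²} F ∧ F̄`.  In a chart in which
`F = a dw₁ ∧ ⋯ ∧ dwₙ`, the density `|F|²` is `2ⁿ |a|²` times Lebesgue measure; the contributions of
the pieces of a countable Borel partition subordinate to charts are summed (by the change of
variables formula, the result does not depend on the partition). -/
def NForm.sqIntegral [SecondCountableTopology M] (F : NForm n M) (w : M → ℝ≥0∞) (S : Set M) :
    ℝ≥0∞ :=
  ∑' p : M, ∫⁻ y in (chartAt (Cn n) p).target ∩
      (chartAt (Cn n) p).symm ⁻¹' (chartSelector n M ⁻¹' {p} ∩ S),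
    2 ^ n * ‖F.coeff (chartAt (Cn n) p) ((chartAt (Cn n) p).symm y)‖ₑ ^ 2 *
      w ((chartAt (Cn n) p).symm y)

/-! ### Minimal `L²` integrals -/

/-- The sublevel set `{ψ < -t}`. -/
def sublevel {M : Type*} (ψ : M → EReal) (t : ℝ) : Set M := {x | ψ x < ((-t : ℝ) : EReal)}

/-- `F` is a holomorphic `(n,0)`-form on `{ψ < -t}` with `(F - f) ∈ H⁰(Z₀, (𝒪(K_M) ⊗ 𝓕)|_{Z₀})`:
at every `z ∈ Z₀` the form `F` is defined and the germ of `F - f`, written in a local coordinate as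
`a dw₁ ∧ ⋯ ∧ dwₙ`, satisfies `a ∈ 𝓕_z`. -/
def Admissible (f : NForm n M) (Z₀ : Set M) (𝓕 : (z : M) → Ideal (HoloGerm n z))
    (ψ : M → EReal) (t : ℝ) (F : NForm n M) : Prop :=
  F.HolomorphicOn (sublevel ψ t) ∧
  ∀ z ∈ Z₀, z ∈ sublevel ψ t ∧ ∃ γ ∈ 𝓕 z,
    (γ : Germ (𝓝 z) ℂ) = ((F - f : NForm n M).coeff (chartAt (Cn n) z) : M → ℂ)

variable [SecondCountableTopology M]

/-- `∫_{ψ < -t} |F|² e^{-φ} c(-ψ)`. -/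
def energy (φ ψ : M → EReal) (c : ℝ → ℝ) (t : ℝ) (F : NForm n M) : ℝ≥0∞ :=
  F.sqIntegral (weight φ ψ c) (sublevel ψ t)

/-- The minimal `L²` integral `G(t; φ, ψ, c)`; it is `+∞` if there is no admissible form. -/
def minimalIntegral (f : NForm n M) (Z₀ : Set M) (𝓕 : (z : M) → Ideal (HoloGerm n z))
    (φ ψ : M → EReal) (c : ℝ → ℝ) (t : ℝ) : ℝ≥0∞ :=
  ⨅ (F : NForm n M) (_ : Admissible f Z₀ 𝓕 ψ t F), energy φ ψ c t F

/-- The space `ℋ²(c, t, φ, ψ)` of admissible forms on `{ψ < -t}` of finite energy. -/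
def H2 (f : NForm n M) (Z₀ : Set M) (𝓕 : (z : M) → Ideal (HoloGerm n z))
    (φ ψ : M → EReal) (c : ℝ → ℝ) (t : ℝ) : Set (NForm n M) :=
  {F | Admissible f Z₀ 𝓕 ψ t F ∧ energy φ ψ c t F < ⊤}

end Manifold

/-- `G(h⁻¹(r))` is a (finite) linear, i.e. affine, function of the real number
`r ∈ [h(T₂), h(T₁)]`, where `h` is strictly decreasing and `r = h(t)`.  If `h(T₁) = +∞`, the real
numbers `r` of this interval are those of `[h(T₂), +∞)`. -/
def LinearBetween (G h : ℝ → ℝ≥0∞) (T₁ T₂ : ℝ) : Prop :=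
  ∃ a b : ℝ, ∀ t ∈ Icc T₁ T₂, ∀ r : ℝ, 0 ≤ r → h t = ENNReal.ofReal r →
    G t ≠ ⊤ ∧ (G t).toReal = a * r + b

end

end MinimalL2

open MinimalL2

/-!
Write `G`, `h` and `G'`, `h'` for the minimal integrals and gain tails of the two data, and `w`, `w'`
for the weights.  The theorem follows from orthogonality, level by level, in the minimum problem of
the second datum; no `L²` extension theorem is needed.

**Comparison of the domains.**  By upper semicontinuity of `ψ'`, near a point where `ψ' < -T₁` the
function `ψ`, which equals `ψ'` on `{-T₂ ≤ ψ < -T₁}`, omits an interval of values just below `-T₁`.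
The sub-mean value inequality then shows that `{ψ < -T₁}` is relatively closed in `{ψ' < -T₁}`
(`sublevel_relatively_closed`).  So a form on `{ψ < -s}` extends by zero to `{ψ' < -s}`, and for
`T₁ ≤ s ≤ T₂` the number `G'(s)` is at most `∫_{ψ < -s} |H|² w'` for each competitor `H` on
`{ψ < -s}`, with equality for `H = F` (`minimalIntegral_le_sqIntegral`).

**Lower bound.**  Let `T₁ < t ≤ T₂` and let `H` have finite energy in the first problem at `t`.  On
each `{ψ < -s}` with `t ≤ s ≤ T₂` the form `F` minimizes the norm with weight `w'` on the line through
`F` and `H`.  Hence the Pythagorean identity holds on all these sets, and the images under `-ψ` of the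
measures `|H|² w'`, `|F|² w'`, `|H - F|² w'` on the shell `{-T₂ ≤ ψ < -t}` satisfy it as measures on
`(t, T₂]`.  On the shell `w` is `w'` times the function `c / c'` of the level, so the shell energy of
`H` for `w` is at least that of `F` (`NForm.sqIntegral_shell_le_of_minimal`).  Since `F` minimizes the
first problem at `T₂`, it minimizes the first problem at `t`.

**Value.**  Linearity of `G'` in `h'` says that the image of `|F|² w'` under `-ψ` is
`k c'(s) e^{-s} ds`.  Multiplication by `c / c'` turns it into `k c(s) e^{-s} ds`
(`NForm.sqIntegral_shell_eq_of_distribution`), so that `G(t) = G(T₂) + k (h(t) - h(T₂))`.  The endpoint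
`t = T₁`, at which `h'` may be infinite, is reached by monotone convergence.

The integrals of forms, defined through a partition subordinate to charts, are handled as integrals
for a single Borel measure on the manifold (`refMeasure`, `NForm.sqIntegral_eq`).
-/

namespace MinimalL2

/-! ### Gaps in the values of a plurisubharmonic function -/

section Gap

variable {n : ℕ} {M : Type*} [TopologicalSpace M] [ChartedSpace (Cn n) M]

/-- On the circle `b + ρ e^{iθ} (a - b)` with `0 < ρ < 1`, the arc `0 < θ ≤ π / 3` lies in the ball
centred at `a` whose boundary passes through `b`. -/
theorem dist_circle_lt {n : ℕ} {a b : Cn n} (hab : a ≠ b) {ρ θ : ℝ} (hρ : 0 < ρ) (hρ1 : ρ < 1)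
    (hθ : θ ∈ Ioc 0 (Real.pi / 3)) :
    dist a (b + Complex.exp (θ * Complex.I) • ((ρ : ℂ) • (a - b))) < dist a b := by
  have hpos : 0 < ‖a - b‖ := norm_pos_iff.2 (sub_ne_zero.2 hab)
  have h1 : a - (b + Complex.exp (θ * Complex.I) • ((ρ : ℂ) • (a - b))) =
      (1 - Complex.exp (θ * Complex.I) * ρ) • (a - b) := by
    rw [sub_smul, one_smul, mul_smul]; abel
  rw [dist_eq_norm, dist_eq_norm, h1, norm_smul]
  refine mul_lt_of_lt_one_left hpos ?_
  have hcos : 1 / 2 ≤ Real.cos θ := by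
    rw [← Real.cos_pi_div_three]
    exact Real.cos_le_cos_of_nonneg_of_le_pi hθ.1.le (by linarith [Real.pi_pos]) hθ.2
  have hsq : ‖1 - Complex.exp (θ * Complex.I) * ρ‖ ^ 2 < 1 := by
    rw [← Complex.normSq_eq_norm_sq, Complex.exp_mul_I, ← Complex.ofReal_cos, ← Complex.ofReal_sin,
      Complex.normSq_apply]
    simp [-Complex.ofReal_cos, -Complex.ofReal_sin]
    have h2 : ρ ^ 2 * (Real.sin θ ^ 2 + Real.cos θ ^ 2) = ρ ^ 2 := by
      rw [Real.sin_sq_add_cos_sq, mul_one]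
    nlinarith [mul_le_mul_of_nonneg_left hcos hρ.le, mul_lt_mul_of_pos_left hρ1 hρ]
  nlinarith [norm_nonneg (1 - Complex.exp (θ * Complex.I) * ρ)]

/-- If a plurisubharmonic function `u` takes no value in `(α - δ, α)` near a point `x` with `u x ≥ α`,
then `x` is not a limit of points of `{u < α}`.  Otherwise some ball contained in `{u ≤ α - δ}` would
have on its boundary a point of `{u ≥ α}`, at which the sub-mean value inequality would fail on the
small circles that enter the ball. -/
theorem IsPSHOn.not_mem_closure_of_gap {u : M → EReal} (hu : IsPSHOn n u univ) {α δ : ℝ}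
    (hδ : 0 < δ) {x : M} {W : Set M} (hW : W ∈ 𝓝 x)
    (hgap : ∀ y ∈ W, u y < (α : EReal) → u y ≤ ((α - δ : ℝ) : EReal))
    (hx : (α : EReal) ≤ u x) : x ∉ closure {y | u y < (α : EReal)} := by
  intro hcl
  have hAo : IsOpen {y | u y < (α : EReal)} := by
    have := (upperSemicontinuousOn_univ_iff.1 hu.2.1).isOpen_preimage (α : EReal)
    exact this
  set e := chartAt (Cn n) x with he
  have hxs : x ∈ e.source := mem_chart_source _ x
  -- a ball around `e x` which the chart maps into `W`
  obtain ⟨R, hR, hball⟩ : ∃ R > 0, Metric.ball (e x) R ⊆ e.target ∩ e.symm ⁻¹' W := by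
    refine Metric.mem_nhds_iff.1 (inter_mem (e.open_target.mem_nhds (e.map_source hxs)) ?_)
    refine (e.continuousAt_symm (e.map_source hxs)).preimage_mem_nhds ?_
    rwa [e.left_inv hxs]
  set V : Set (Cn n) := e.target ∩ e.symm ⁻¹' {y | u y < (α : EReal)} with hV
  have hVo : IsOpen V := e.isOpen_inter_preimage_symm hAo
  have hxV : e x ∈ Vᶜ := by
    rintro ⟨_, h⟩
    simp only [mem_preimage, e.left_inv hxs, mem_ofPred_eq] at h
    exact absurd h (not_lt.2 hx)
  obtain ⟨a, haV, haR⟩ : ∃ a ∈ V, dist a (e x) < R / 4 := by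
    have hnb : e.source ∩ e ⁻¹' Metric.ball (e x) (R / 4) ∈ 𝓝 x :=
      inter_mem (e.open_source.mem_nhds hxs)
        ((e.continuousAt hxs).preimage_mem_nhds (Metric.ball_mem_nhds _ (by positivity)))
    obtain ⟨y, ⟨hys, hyb⟩, hyA⟩ := mem_closure_iff_nhds.1 hcl _ hnb
    exact ⟨e y, ⟨e.map_source hys, by simpa [e.left_inv hys] using hyA⟩, hyb⟩
  -- the largest ball around `a` contained in `V` touches the complement of `V` at `b`
  obtain ⟨b, hbV, hb⟩ := hVo.isClosed_compl.exists_infDist_eq_dist ⟨_, hxV⟩ a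
  have hab : a ≠ b := by rintro rfl; exact hbV haV
  have hinner : ∀ y, dist a y < dist a b → y ∈ V := by
    intro y hy
    by_contra hyV
    exact absurd (Metric.infDist_le_dist_of_mem (x := a) (show y ∈ Vᶜ from hyV))
      (not_le.2 (hb ▸ hy))
  have habR : dist a b < R / 4 := by
    rw [← hb]; exact (Metric.infDist_le_dist_of_mem hxV).trans_lt haR
  have hbR : dist b (e x) < R / 2 := by
    calc dist b (e x) ≤ dist b a + dist a (e x) := dist_triangle _ _ _
      _ < R / 2 := by rw [dist_comm b a]; linarith
  have hbt : b ∈ e.target := (hball (Metric.mem_ball.2 (by linarith))).1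
  have hub : (α : EReal) ≤ u (e.symm b) := by
    by_contra h
    exact hbV ⟨hbt, not_le.1 h⟩
  obtain ⟨β, hβ⟩ : ∃ β : ℝ, u (e.symm b) = β := by
    refine ⟨(u (e.symm b)).toReal, (EReal.coe_toReal (hu.1 _ (mem_univ _)) ?_).symm⟩
    intro h
    rw [h] at hub
    exact absurd hub (not_le.2 (EReal.bot_lt_coe α))
  have hαβ : α ≤ β := by rw [hβ] at hub; exact_mod_cast hub
  -- the excess `ε` of the upper bound over `u b`; a sixth of the circle lies in the ball, so that
  -- `ε < δ / 5` contradicts the sub-mean value inequality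
  set ε : ℝ := δ / 12 with hε
  have hε0 : 0 < ε := by positivity
  obtain ⟨r, hr, hrb⟩ : ∃ r > 0, Metric.ball b r ⊆
      {y | u (e.symm y) < ((β + ε : ℝ) : EReal)} ∩ Metric.ball (e x) R := by
    refine Metric.mem_nhds_iff.1 (inter_mem ?_ (Metric.isOpen_ball.mem_nhds
      (Metric.mem_ball.2 (by linarith))))
    refine (e.continuousAt_symm hbt).preimage_mem_nhds
      (t := {y | u y < ((β + ε : ℝ) : EReal)}) ?_
    have := upperSemicontinuousOn_univ_iff.1 hu.2.1 (e.symm b) ((β + ε : ℝ) : EReal)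
      (by
        change u (e.symm b) < _
        rw [hβ]
        exact EReal.coe_lt_coe (by linarith))
    exact this
  obtain ⟨ρ, hρ, hρ1, hρr⟩ : ∃ ρ : ℝ, 0 < ρ ∧ ρ < 1 ∧ ρ * dist a b < r := by
    have hd : 0 < dist a b := dist_pos.2 hab
    refine ⟨min (1 / 2) (r / (2 * dist a b)), by positivity, ?_, ?_⟩
    · exact (min_le_left _ _).trans_lt (by norm_num)
    · calc min (1 / 2) (r / (2 * dist a b)) * dist a b
          ≤ r / (2 * dist a b) * dist a b := by gcongr; exact min_le_right _ _
        _ = r / 2 := by field_simp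
        _ < r := by linarith
  set v : Cn n := (ρ : ℂ) • (a - b) with hv
  have hdisc : ∀ ζ : ℂ, ‖ζ‖ ≤ 1 → b + ζ • v ∈ Metric.ball b r := by
    intro ζ hζ
    rw [Metric.mem_ball, dist_eq_norm, add_sub_cancel_left, hv, norm_smul, norm_smul,
      Complex.norm_real, Real.norm_of_nonneg hρ.le, ← dist_eq_norm]
    exact (mul_le_of_le_one_left (by positivity) hζ).trans_lt hρr
  have hmean := hu.2.2.2 e (chart_mem_atlas _ x) b v
    (fun ζ hζ => ⟨(hball (hrb (hdisc ζ hζ)).2).1, mem_univ _⟩) (β + ε)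
    (fun ζ hζ => (hrb (hdisc ζ hζ)).1.le)
  rw [hβ] at hmean
  have hlow : ENNReal.ofReal (δ + ε) * ENNReal.ofReal (Real.pi / 3) ≤
      ∫⁻ θ in Ioc (0 : ℝ) (2 * Real.pi), ((((β + ε : ℝ) : EReal) -
        u (e.symm (b + Complex.exp (θ * Complex.I) • v))).toENNReal) := by
    calc ENNReal.ofReal (δ + ε) * ENNReal.ofReal (Real.pi / 3)
        = ∫⁻ _ in Ioc (0 : ℝ) (Real.pi / 3), ENNReal.ofReal (δ + ε) := by
          rw [setLIntegral_const, Real.volume_Ioc, sub_zero]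
      _ ≤ ∫⁻ θ in Ioc (0 : ℝ) (Real.pi / 3), ((((β + ε : ℝ) : EReal) -
            u (e.symm (b + Complex.exp (θ * Complex.I) • v))).toENNReal) := by
          refine setLIntegral_mono' measurableSet_Ioc fun θ hθ => ?_
          have hmem : b + Complex.exp (θ * Complex.I) • v ∈ V :=
            hinner _ (dist_circle_lt hab hρ hρ1 hθ)
          have hle := hgap _ (hball (hrb (hdisc (Complex.exp (θ * Complex.I))
            (by rw [Complex.norm_exp_ofReal_mul_I]))).2).2 hmem.2
          rw [← EReal.real_coe_toENNReal]
          refine EReal.toENNReal_le_toENNReal ?_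
          calc ((δ + ε : ℝ) : EReal) ≤ ((β + ε - (α - δ) : ℝ) : EReal) :=
                EReal.coe_le_coe (by linarith)
            _ = ((β + ε : ℝ) : EReal) - ((α - δ : ℝ) : EReal) := EReal.coe_sub _ _
            _ ≤ _ := EReal.sub_le_sub le_rfl hle
      _ ≤ _ := by
          refine lintegral_mono_set (Ioc_subset_Ioc_right ?_)
          linarith [Real.pi_pos]
  have hfin := hlow.trans hmean
  rw [← EReal.coe_sub, EReal.toENNReal_of_ne_top (EReal.coe_ne_top _), EReal.toReal_coe,
    ← ENNReal.ofReal_mul (by positivity), ← ENNReal.ofReal_mul (by positivity),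
    add_sub_cancel_left, ENNReal.ofReal_le_ofReal_iff (by positivity)] at hfin
  nlinarith [Real.pi_pos]

/-- If `ψ'` coincides with `ψ` on the shell `{-T₂ ≤ ψ < -T₁}`, then `{ψ < -T₁}` has no boundary point
in `{ψ' < -T₁}`.  Near a point where `ψ' < -T₁`, upper
semicontinuity of `ψ'` forces a gap in the values of `ψ`. -/
theorem sublevel_relatively_closed {ψ ψ' : M → EReal} (hψ : IsPSHOn n ψ univ)
    (hψ' : IsPSHOn n ψ' univ) {T₁ T₂ : ℝ} (hT : T₁ < T₂)
    (h2 : ∀ x, ((-T₂ : ℝ) : EReal) ≤ ψ x → ψ x < ((-T₁ : ℝ) : EReal) → ψ' x = ψ x)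
    {x : M} (hx' : x ∈ sublevel ψ' T₁) (hx : x ∉ sublevel ψ T₁) :
    x ∉ closure (sublevel ψ T₁) := by
  obtain ⟨q, hq1, hq2⟩ := EReal.lt_iff_exists_real_btwn.1 hx'
  have hq2' : q < -T₁ := by exact_mod_cast hq2
  have hm : max q (-T₂) < -T₁ := max_lt hq2' (by linarith)
  refine hψ.not_mem_closure_of_gap (δ := -T₁ - max q (-T₂)) (by linarith)
    (W := {y | ψ' y < (q : EReal)}) (upperSemicontinuousOn_univ_iff.1 hψ'.2.1 x q hq1) ?_
    (not_lt.1 hx)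
  intro y hy hyT
  rw [sub_sub_cancel]
  rcases le_or_gt ((-T₂ : ℝ) : EReal) (ψ y) with h | h
  · rw [← h2 y h hyT]
    exact (le_of_lt hy).trans (by exact_mod_cast le_max_left _ _)
  · exact h.le.trans (by exact_mod_cast le_max_right _ _)

end Gap

/-! ### Integrals of forms as integrals over the manifold -/

section Reference

variable {n : ℕ} {M : Type*} [TopologicalSpace M]

section

variable [MeasurableSpace M] [BorelSpace M]

theorem measurableEmbedding_chart_symm (e : OpenPartialHomeomorph M (Cn n)) :
    MeasurableEmbedding (e.target.domRestrict e.symm) :=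
  e.symm.isOpenEmbedding_restrict.measurableEmbedding

/-- Lebesgue measure of the chart `e`, transported to `M`. -/
noncomputable def chartVolume (e : OpenPartialHomeomorph M (Cn n)) : Measure M :=
  ((volume : Measure (Cn n)).comap (Subtype.val : e.target → Cn n)).map
    (e.target.domRestrict e.symm)

theorem setLIntegral_chartVolume (e : OpenPartialHomeomorph M (Cn n)) (g : M → ℝ≥0∞) (S : Set M) :
    ∫⁻ x in S, g x ∂(chartVolume e) = ∫⁻ y in e.target ∩ e.symm ⁻¹' S, g (e.symm y) := by
  have he := measurableEmbedding_chart_symm e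
  rw [chartVolume, he.restrict_map, he.lintegral_map]
  have h := setLIntegral_subtype (μ := (volume : Measure (Cn n))) e.open_target.measurableSet
    (e.target.domRestrict e.symm ⁻¹' S) (fun y => g (e.symm y))
  have himg : (Subtype.val : e.target → Cn n) '' (e.target.domRestrict e.symm ⁻¹' S) =
      e.target ∩ e.symm ⁻¹' S := by
    ext y
    simp [Set.domRestrict, and_comm]
  rw [← himg, ← h]
  rfl

theorem measurableSet_chart_preimage (e : OpenPartialHomeomorph M (Cn n)) {S : Set M}
    (hS : MeasurableSet S) : MeasurableSet (e.target ∩ e.symm ⁻¹' S) := by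
  have h := e.open_target.measurableSet.subtype_image
    ((measurableEmbedding_chart_symm e).measurable hS)
  convert h using 1
  ext y
  simp [Set.domRestrict, and_comm]

end

variable [ChartedSpace (Cn n) M]

theorem LebesgueMeasurable.aemeasurable_chartVolume [MeasurableSpace M] [BorelSpace M]
    {φ : M → EReal} (hφ : LebesgueMeasurable n φ) {e : OpenPartialHomeomorph M (Cn n)}
    (he : e ∈ atlas (Cn n) M) : AEMeasurable φ (chartVolume e) := by
  rw [chartVolume, (measurableEmbedding_chart_symm e).aemeasurable_map_iff]
  exact (aemeasurable_restrict_iff_comap_subtype e.open_target.measurableSet).1 (hφ e he)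

section

variable [SecondCountableTopology M]

theorem mem_source_chartSelector (x : M) :
    x ∈ (chartAt (Cn n) (chartSelector n M x)).source :=
  (exists_chartSelector n M).choose_spec.1 x

theorem countable_range_chartSelector : (range (chartSelector n M)).Countable :=
  (exists_chartSelector n M).choose_spec.2.1

variable [MeasurableSpace M] [BorelSpace M]

theorem measurableSet_chartSelector (p : M) : MeasurableSet (chartSelector n M ⁻¹' {p}) := by
  rw [BorelSpace.measurable_eq (α := M)]
  exact (exists_chartSelector n M).choose_spec.2.2 p

variable (n M) in
/-- The measure on `M` which on each piece of the partition `chartSelector` is Lebesgue measure of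
the selected chart.  Only the countably many selected charts are summed, so that measurability can be
checked chart by chart. -/
noncomputable def refMeasure : Measure M :=
  Measure.sum fun p : range (chartSelector n M) =>
    (chartVolume (chartAt (Cn n) (p : M))).restrict (chartSelector n M ⁻¹' {(p : M)})

/-- The coefficient of a form at `x`, in the chart selected at `x`. -/
noncomputable def NForm.selectedCoeff (F : NForm n M) (x : M) : ℂ :=
  F.coeff (chartAt (Cn n) (chartSelector n M x)) x

/-- Integrals of forms are integrals of functions on `M`, because on each piece of the partition the
selected coefficient is the coefficient in the chart of this piece. -/
theorem NForm.sqIntegral_eq (F : NForm n M) (w : M → ℝ≥0∞) {S : Set M} (hS : MeasurableSet S) :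
    F.sqIntegral w S = ∫⁻ x in S, 2 ^ n * ‖F.selectedCoeff x‖ₑ ^ 2 * w x ∂(refMeasure n M) := by
  rw [refMeasure, Measure.restrict_sum _ hS, lintegral_sum_measure, NForm.sqIntegral]
  rw [← tsum_subtype_eq_of_support_subset (s := range (chartSelector n M))]
  · refine tsum_congr fun p => ?_
    rw [Measure.restrict_restrict hS, setLIntegral_chartVolume, inter_comm S]
    refine setLIntegral_congr_fun (measurableSet_chart_preimage _
      ((measurableSet_chartSelector (p : M)).inter hS)) fun y hy => ?_
    have : chartSelector n M ((chartAt (Cn n) (p : M)).symm y) = p := hy.2.1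
    simp only [NForm.selectedCoeff, this]
  · intro p hp
    by_contra h
    refine hp ?_
    have : chartSelector n M ⁻¹' {p} = ∅ := by
      ext x
      simp only [mem_preimage, mem_singleton_iff, mem_empty_iff_false, iff_false]
      rintro rfl
      exact h (mem_range_self _)
    simp [this]

theorem LebesgueMeasurable.aemeasurable {φ : M → EReal} (hφ : LebesgueMeasurable n φ) :
    AEMeasurable φ (refMeasure n M) := by
  have := (countable_range_chartSelector (n := n) (M := M)).to_subtype
  refine aemeasurable_sum_measure_iff.2 fun p => ?_
  exact (hφ.aemeasurable_chartVolume (chart_mem_atlas _ _)).restrict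

theorem NForm.HolomorphicOn.aemeasurable_selectedCoeff {F : NForm n M} {Ω : Set M}
    (hF : F.HolomorphicOn Ω) (hΩ : IsOpen Ω) :
    AEMeasurable F.selectedCoeff ((refMeasure n M).restrict Ω) := by
  have hcount := (countable_range_chartSelector (n := n) (M := M)).to_subtype
  have hcov : Ω = ⋃ p : range (chartSelector n M), Ω ∩ chartSelector n M ⁻¹' {(p : M)} := by
    ext x; simp
  rw [hcov, aemeasurable_iUnion_iff]
  intro p
  set e := chartAt (Cn n) (p : M) with he
  have hcont : ContinuousOn (F.coeff e) (e.source ∩ Ω) := by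
    have h1 := (hF e (chart_mem_atlas _ _)).continuousOn
    have h2 : ContinuousOn (fun x => F.coeff e (e.symm (e x))) (e.source ∩ Ω) := by
      refine h1.comp (e.continuousOn.mono inter_subset_left) fun x hx => ⟨e.map_source hx.1, ?_⟩
      simpa [e.left_inv hx.1] using hx.2
    exact h2.congr fun x hx => by simp only [e.left_inv hx.1]
  have hm : AEMeasurable (F.coeff e)
      ((refMeasure n M).restrict (Ω ∩ chartSelector n M ⁻¹' {(p : M)})) := by
    refine (hcont.aemeasurable (e.open_source.inter hΩ).measurableSet).mono_measure
      (Measure.restrict_mono ?_ le_rfl)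
    rintro x ⟨hx, hxp⟩
    refine ⟨?_, hx⟩
    have := mem_source_chartSelector (n := n) x
    rwa [show chartSelector n M x = p from hxp] at this
  refine hm.congr ?_
  refine (ae_restrict_iff' (hΩ.measurableSet.inter (measurableSet_chartSelector _))).2
    (Eventually.of_forall fun x hx => ?_)
  have : chartSelector n M x = p := hx.2
  simp only [NForm.selectedCoeff, this, ← he]

end

/-! ### Linear operations on forms -/

theorem NForm.coeff_congr {F G : NForm n M} {x : M} (h : F x = G x)
    (e : OpenPartialHomeomorph M (Cn n)) : F.coeff e x = G.coeff e x := by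
  rw [NForm.coeff, NForm.coeff, h]

theorem NForm.coeff_add (F G : NForm n M) (e : OpenPartialHomeomorph M (Cn n)) (x : M) :
    (F + G).coeff e x = F.coeff e x + G.coeff e x := rfl

theorem NForm.coeff_sub (F G : NForm n M) (e : OpenPartialHomeomorph M (Cn n)) (x : M) :
    (F - G).coeff e x = F.coeff e x - G.coeff e x := rfl

theorem NForm.coeff_smul (k : ℂ) (F : NForm n M) (e : OpenPartialHomeomorph M (Cn n)) (x : M) :
    (k • F).coeff e x = k * F.coeff e x := rfl

theorem NForm.HolomorphicOn.mono {F : NForm n M} {Ω Ω' : Set M} (hF : F.HolomorphicOn Ω)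
    (h : Ω' ⊆ Ω) : F.HolomorphicOn Ω' :=
  fun e he => (hF e he).mono (inter_subset_inter_right _ (preimage_mono h))

theorem NForm.HolomorphicOn.sub {F G : NForm n M} {Ω : Set M} (hF : F.HolomorphicOn Ω)
    (hG : G.HolomorphicOn Ω) : (F - G : NForm n M).HolomorphicOn Ω :=
  fun e he => (hF e he).sub (hG e he)

theorem NForm.HolomorphicOn.add_smul {F G : NForm n M} {Ω : Set M} (hF : F.HolomorphicOn Ω)
    (hG : G.HolomorphicOn Ω) (k : ℂ) : (F + k • G : NForm n M).HolomorphicOn Ω :=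
  fun e he => (hF e he).add ((hG e he).const_mul k)

open Classical in
/-- Extension by zero of a holomorphic form from an open subset to an open set in which it is
relatively closed. -/
theorem NForm.HolomorphicOn.piecewise_zero {H : NForm n M} {A Ω : Set M} (hA : IsOpen A)
    (hΩ : IsOpen Ω) (hcl : ∀ x ∈ Ω, x ∉ A → x ∉ closure A) (hH : H.HolomorphicOn (A ∩ Ω)) :
    NForm.HolomorphicOn (A.piecewise H 0 : NForm n M) Ω := by
  rintro e he y ⟨hyt, hyΩ⟩
  have hsymm : ContinuousAt e.symm y := e.continuousAt_symm hyt
  refine DifferentiableAt.differentiableWithinAt ?_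
  by_cases hyA : e.symm y ∈ A
  · have hd : DifferentiableAt ℂ (fun y => H.coeff e (e.symm y)) y :=
      (hH e he).differentiableAt ((e.isOpen_inter_preimage_symm (hA.inter hΩ)).mem_nhds
        ⟨hyt, hyA, hyΩ⟩)
    refine hd.congr_of_eventuallyEq ?_
    filter_upwards [hsymm.preimage_mem_nhds (hA.mem_nhds hyA)] with z hz
    exact NForm.coeff_congr (piecewise_eq_of_mem A H 0 hz) e
  · refine (differentiableAt_const (0 : ℂ)).congr_of_eventuallyEq ?_
    filter_upwards [hsymm.preimage_mem_nhds
      (isClosed_closure.isOpen_compl.mem_nhds (hcl _ hyΩ hyA))] with z hz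
    exact NForm.coeff_congr (G := 0)
      (piecewise_eq_of_notMem A H 0 (fun h => hz (subset_closure h))) e

theorem Admissible.mono {f : NForm n M} {Z₀ : Set M} {𝓕 : (z : M) → Ideal (HoloGerm n z)}
    {ψ : M → EReal} {s t : ℝ} (hst : sublevel ψ t ⊆ sublevel ψ s) {F : NForm n M}
    (hF : Admissible f Z₀ 𝓕 ψ s F) (hZ : Z₀ ⊆ sublevel ψ t) : Admissible f Z₀ 𝓕 ψ t F :=
  ⟨hF.1.mono hst, fun z hz => ⟨hZ hz, (hF.2 z hz).2⟩⟩

/-- Admissible forms make up an affine space. -/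
theorem Admissible.line {f : NForm n M} {Z₀ : Set M} {𝓕 : (z : M) → Ideal (HoloGerm n z)}
    {ψ : M → EReal} {t : ℝ} {F H : NForm n M} (hF : Admissible f Z₀ 𝓕 ψ t F)
    (hH : Admissible f Z₀ 𝓕 ψ t H) (k : ℂ) :
    Admissible f Z₀ 𝓕 ψ t (F + k • (H - F)) := by
  refine ⟨hF.1.add_smul (hH.1.sub hF.1) k, fun z hz => ?_⟩
  obtain ⟨hzs, γ, hγ, hγe⟩ := hF.2 z hz
  obtain ⟨-, δ, hδ, hδe⟩ := hH.2 z hz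
  let κ : HoloGerm n z := ⟨((fun _ => k : M → ℂ) : Germ (𝓝 z) ℂ),
    ⟨_, Eventually.of_forall fun _ => mdifferentiableAt_const, rfl⟩⟩
  refine ⟨hzs, γ + κ * (δ - γ), Ideal.add_mem _ hγ (Ideal.mul_mem_left _ _
    (Ideal.sub_mem _ hδ hγ)), ?_⟩
  have h1 : ((γ + κ * (δ - γ) : HoloGerm n z) : Germ (𝓝 z) ℂ) =
      (γ : Germ (𝓝 z) ℂ) + ((fun _ => k : M → ℂ) : Germ (𝓝 z) ℂ) *
        ((δ : Germ (𝓝 z) ℂ) - (γ : Germ (𝓝 z) ℂ)) := rfl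
  rw [h1, hγe, hδe, ← Germ.coe_sub, ← Germ.coe_mul, ← Germ.coe_add]
  congr 1
  funext x
  simp only [Pi.add_apply, Pi.mul_apply, Pi.sub_apply, NForm.coeff_add, NForm.coeff_sub,
    NForm.coeff_smul]
  ring

end Reference

/-! ### Square-integrable functions and measures on the line -/

section Measure

/-- Minimality of the `L²` norm along the line `a + ε (b - a)` is orthogonality of `a` and `b - a`,
in the form of the Pythagorean identity. -/
theorem lintegral_sq_eq_add_of_minimal {X : Type*} [MeasurableSpace X] {ν : Measure X}
    {a b : X → ℂ} (ha : AEStronglyMeasurable a ν) (hb : AEStronglyMeasurable b ν)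
    (ha2 : ∫⁻ x, ‖a x‖ₑ ^ 2 ∂ν < ⊤) (hb2 : ∫⁻ x, ‖b x‖ₑ ^ 2 ∂ν < ⊤)
    (hmin : ∀ ε : ℝ, ∫⁻ x, ‖a x‖ₑ ^ 2 ∂ν ≤ ∫⁻ x, ‖a x + (ε : ℂ) * (b x - a x)‖ₑ ^ 2 ∂ν) :
    ∫⁻ x, ‖b x‖ₑ ^ 2 ∂ν = ∫⁻ x, ‖a x‖ₑ ^ 2 ∂ν + ∫⁻ x, ‖b x - a x‖ₑ ^ 2 ∂ν := by
  have key : ∀ g : X → ℂ, (hg : MemLp g 2 ν) →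
      ∫⁻ x, ‖g x‖ₑ ^ 2 ∂ν = ENNReal.ofReal (‖hg.toLp g‖ ^ 2) := by
    intro g hg
    rw [Lp.norm_toLp, ← ENNReal.toReal_pow, ENNReal.ofReal_toReal (ENNReal.pow_ne_top hg.2.ne),
      eLpNorm_eq_lintegral_rpow_enorm_toReal two_ne_zero ENNReal.ofNat_ne_top]
    rw [← ENNReal.rpow_natCast, ← ENNReal.rpow_mul]
    simp
  have mem : ∀ g : X → ℂ, AEStronglyMeasurable g ν → ∫⁻ x, ‖g x‖ₑ ^ 2 ∂ν < ⊤ → MemLp g 2 ν := by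
    intro g hg h
    refine ⟨hg, ?_⟩
    rw [eLpNorm_eq_lintegral_rpow_enorm_toReal two_ne_zero ENNReal.ofNat_ne_top]
    refine ENNReal.rpow_lt_top_of_nonneg (by simp) ?_
    simpa using h.ne
  have hA := mem a ha ha2
  have hB := mem b hb hb2
  have hD : MemLp (fun x => b x - a x) 2 ν := hB.sub hA
  have hmin' : ∀ ε : ℝ, ‖hA.toLp a‖ ^ 2 ≤ ‖hA.toLp a + (ε : ℂ) • hD.toLp _‖ ^ 2 := by
    intro ε
    have h := hmin ε
    have hE : MemLp (fun x => a x + (ε : ℂ) * (b x - a x)) 2 ν := hA.add (hD.const_mul _)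
    rw [key a hA, key _ hE, ENNReal.ofReal_le_ofReal_iff (by positivity)] at h
    exact h
  have horth : RCLike.re (inner ℂ (hA.toLp a) (hD.toLp _)) = 0 := by
    set I := RCLike.re (inner ℂ (hA.toLp a) (hD.toLp _)) with hI
    set C := ‖hD.toLp _‖ ^ 2 with hC
    have hC0 : 0 ≤ C := by positivity
    have hq : ∀ ε : ℝ, 0 ≤ 2 * ε * I + ε ^ 2 * C := by
      intro ε
      have h := hmin' ε
      rw [@norm_add_sq ℂ, inner_smul_right, norm_smul, mul_pow] at h
      simp [-Lp.norm_toLp] at h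
      simp only [hI, hC, RCLike.re_to_complex]
      linarith
    -- the minimum of the quadratic is at `-I / C`; the `1` avoids a division by zero
    have h1 := hq (-I / (C + 1))
    have hC1 : 0 < C + 1 := by linarith
    have h2 : 2 * (-I / (C + 1)) * I + (-I / (C + 1)) ^ 2 * C =
        -(I ^ 2 * (C + 2)) / (C + 1) ^ 2 := by field_simp; ring
    rw [h2, le_div_iff₀ (by positivity)] at h1
    nlinarith [sq_nonneg I]
  rw [key a hA, key b hB, key _ hD, ← ENNReal.ofReal_add (by positivity) (by positivity)]
  congr 1
  have : hB.toLp b = hA.toLp a + hD.toLp _ := by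
    rw [← MemLp.toLp_add]
    congr 1
    funext x
    simp
  rw [this, @norm_add_sq ℂ, horth]
  ring

/-- Two measures on the line which give the same finite mass to the intervals `(s, T]` with
`t ≤ s` coincide on `(t, T]`. -/
theorem restrict_Ioc_eq_of_forall {α β : Measure ℝ} {t T : ℝ}
    (hfin : α (Ioc t T) ≠ ⊤) (h : ∀ s ∈ Icc t T, α (Ioc s T) = β (Ioc s T)) :
    α.restrict (Ioc t T) = β.restrict (Ioc t T) := by
  rcases lt_or_ge T t with hT | hT
  · rw [Ioc_eq_empty (by linarith)]; simp
  have : IsFiniteMeasure (α.restrict (Ioc t T)) := ⟨by simpa using hfin.lt_top⟩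
  refine ext_of_generate_finite (range Ioi) (borel_eq_generateFrom_Ioi ℝ ▸ BorelSpace.measurable_eq)
    isPiSystem_Ioi ?_ ?_
  · rintro _ ⟨x, rfl⟩
    rw [Measure.restrict_apply measurableSet_Ioi, Measure.restrict_apply measurableSet_Ioi]
    have hI : Ioi x ∩ Ioc t T = Ioc (max t x) T := by
      ext y; simp only [mem_inter_iff, mem_Ioi, mem_Ioc, max_lt_iff]; tauto
    rw [hI]
    rcases le_or_gt (max t x) T with h1 | h1
    · exact h _ ⟨le_max_left _ _, h1⟩
    · rw [Ioc_eq_empty (by linarith)]; simp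
  · simpa using h t ⟨le_rfl, hT⟩

end Measure

/-! ### Gains -/

section Gain

open Classical in
/-- The density `c(t) e^{-t}`, extended by `+∞` to `t ≤ T` so that it is antitone on the line. -/
noncomputable def gainDensity (T : EReal) (c : ℝ → ℝ) (t : ℝ) : ℝ≥0∞ :=
  if T < (t : EReal) then ENNReal.ofReal (c t * Real.exp (-t)) else ⊤

theorem gainDensity_of_lt {T : EReal} {c : ℝ → ℝ} {t : ℝ} (ht : T < (t : EReal)) :
    gainDensity T c t = ENNReal.ofReal (c t * Real.exp (-t)) := if_pos ht

variable {M : Type*} [TopologicalSpace M] {Z : Set M} {T : EReal} {φ ψ : M → EReal} {c : ℝ → ℝ}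

theorem IsGain.antitone_gainDensity (hc : IsGain Z T φ ψ c) : Antitone (gainDensity T c) := by
  intro s t hst
  by_cases hs : T < (s : EReal)
  · have ht : T < (t : EReal) := hs.trans_le (by exact_mod_cast hst)
    rw [gainDensity_of_lt hs, gainDensity_of_lt ht]
    exact ENNReal.ofReal_le_ofReal (hc.antitone hs ht hst)
  · simp [gainDensity, hs]

theorem IsGain.measurable_gainDensity (hc : IsGain Z T φ ψ c) : Measurable (gainDensity T c) :=
  hc.antitone_gainDensity.measurable

theorem IsGain.gainDensity_ne_zero (hc : IsGain Z T φ ψ c) {t : ℝ} (ht : T < (t : EReal)) :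
    gainDensity T c t ≠ 0 := by
  rw [gainDensity_of_lt ht]
  exact (ENNReal.ofReal_pos.2 (mul_pos (hc.pos t ht) (Real.exp_pos _))).ne'

theorem gainDensity_ne_top {t : ℝ} (ht : T < (t : EReal)) : gainDensity T c t ≠ ⊤ := by
  rw [gainDensity_of_lt ht]
  exact ENNReal.ofReal_ne_top

theorem gainTail_eq_add {t T₂ : ℝ} (hT : T ≤ (t : EReal)) (htT : t ≤ T₂) :
    gainTail c t = gainTail c T₂ + ∫⁻ s in Ioc t T₂, gainDensity T c s := by
  have h1 : ∫⁻ s in Ioc t T₂, gainDensity T c s =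
      ∫⁻ s in Ioc t T₂, ENNReal.ofReal (c s * Real.exp (-s)) :=
    setLIntegral_congr_fun measurableSet_Ioc fun s hs =>
      gainDensity_of_lt (hT.trans_lt (by exact_mod_cast hs.1))
  rw [h1, gainTail, gainTail, ← Ioc_union_Ioi_eq_Ioi htT,
    lintegral_union measurableSet_Ioi Ioc_disjoint_Ioi_same, add_comm]

theorem IsGain.gainTail_lt_top (hc : IsGain Z T φ ψ c) {t T₂ : ℝ} (hT : T < (t : EReal))
    (htT : t ≤ T₂) (hfin : gainTail c T₂ < ⊤) : gainTail c t < ⊤ := by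
  rw [gainTail_eq_add hT.le htT]
  refine ENNReal.add_lt_top.2 ⟨hfin, ?_⟩
  calc ∫⁻ s in Ioc t T₂, gainDensity T c s ≤ ∫⁻ _ in Ioc t T₂, gainDensity T c t :=
        setLIntegral_mono' measurableSet_Ioc fun s hs => hc.antitone_gainDensity hs.1.le
    _ < ⊤ := by
        rw [setLIntegral_const, Real.volume_Ioc]
        exact ENNReal.mul_lt_top (gainDensity_ne_top hT).lt_top ENNReal.ofReal_lt_top

variable {n : ℕ} [ChartedSpace (Cn n) M]

theorem IsPSHOn.isOpen_sublevel (hψ : IsPSHOn n ψ univ) (t : ℝ) : IsOpen (sublevel ψ t) :=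
  (upperSemicontinuousOn_univ_iff.1 hψ.2.1).isOpen_preimage _

variable [MeasurableSpace M] [BorelSpace M]

theorem IsPSHOn.measurable (hψ : IsPSHOn n ψ univ) : Measurable ψ :=
  measurable_of_Iio fun a =>
    ((upperSemicontinuousOn_univ_iff.1 hψ.2.1).isOpen_preimage a).measurableSet

theorem IsGain.aemeasurable_weight [SecondCountableTopology M] (hc : IsGain Z T φ ψ c)
    (hφ : LebesgueMeasurable n φ) (hψ : IsPSHOn n ψ univ) (hψT : ∀ x, ψ x < -T) :
    AEMeasurable (weight φ ψ c) (refMeasure n M) := by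
  refine (EReal.measurable_exp.comp_aemeasurable hφ.aemeasurable.neg).mul
    (Measurable.aemeasurable ?_)
  classical
  -- at the poles of `ψ` the gain is evaluated at the junk value `0` of `(-ψ x).toReal`
  have heq : (fun x => ENNReal.ofReal (c (-(ψ x)).toReal)) = fun x =>
      if ψ x = ⊥ then ENNReal.ofReal (c 0) else gainDensity T c (-(ψ x)).toReal *
        ENNReal.ofReal (Real.exp (-(ψ x)).toReal) := by
    funext x
    by_cases hx : ψ x = ⊥
    · simp [hx]
    · have hfin : (((-(ψ x)).toReal : ℝ) : EReal) = -(ψ x) :=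
        EReal.coe_toReal (by simpa using hx) (by simpa using hψ.1 x (mem_univ x))
      have hlt : T < (((-(ψ x)).toReal : ℝ) : EReal) := by
        rw [hfin]; exact EReal.lt_neg_comm.1 (hψT x)
      rw [if_neg hx, gainDensity_of_lt hlt, ← ENNReal.ofReal_mul
        (mul_nonneg (hc.pos _ hlt).le (Real.exp_pos _).le), mul_assoc, ← Real.exp_add]
      simp
  rw [heq]
  have hσ : Measurable fun x => (-(ψ x)).toReal := hψ.measurable.neg.ereal_toReal
  exact Measurable.ite (hψ.measurable (measurableSet_singleton _)) measurable_const
    ((hc.measurable_gainDensity.comp hσ).mul (Real.measurable_exp.comp hσ).ennreal_ofReal)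

end Gain

/-! ### Shells and the distribution of the density of a form over the levels of `ψ` -/

section Shell

theorem sublevel_anti {M : Type*} {ψ : M → EReal} {s t : ℝ} (h : s ≤ t) :
    sublevel ψ t ⊆ sublevel ψ s :=
  fun x (hx : ψ x < _) => lt_of_lt_of_le hx (by exact_mod_cast neg_le_neg h)

/-- The shell `{-T₂ ≤ ψ < -t}`. -/
def shell {M : Type*} (ψ : M → EReal) (t T₂ : ℝ) : Set M :=
  sublevel ψ t \ sublevel ψ T₂

theorem mem_shell_iff {M : Type*} {ψ : M → EReal} {t T₂ : ℝ} {x : M} :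
    x ∈ shell ψ t T₂ ↔ ∃ s ∈ Ioc t T₂, ψ x = ((-s : ℝ) : EReal) := by
  constructor
  · rintro ⟨h1 : ψ x < _, h2 : ¬ ψ x < _⟩
    rw [not_lt] at h2
    obtain ⟨s, hs⟩ : ∃ s : ℝ, ψ x = s :=
      ⟨_, (EReal.coe_toReal (h1.trans (EReal.coe_lt_top _)).ne
        ((EReal.bot_lt_coe _).trans_le h2).ne').symm⟩
    rw [hs] at h1 h2
    have h1' : s < -t := by exact_mod_cast h1
    have h2' : -T₂ ≤ s := by exact_mod_cast h2
    exact ⟨-s, ⟨by linarith, by linarith⟩, by rw [neg_neg, hs]⟩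
  · rintro ⟨s, hs, hx⟩
    refine ⟨?_, ?_⟩
    · change ψ x < _
      rw [hx]; exact EReal.coe_lt_coe (by linarith [hs.1])
    · change ¬ ψ x < _
      rw [hx, not_lt]; exact EReal.coe_le_coe (by linarith [hs.2])

theorem toReal_neg_of_eq {a : EReal} {s : ℝ} (h : a = ((-s : ℝ) : EReal)) : (-a).toReal = s := by
  rw [h, ← EReal.coe_neg, neg_neg, EReal.toReal_coe]

variable {n : ℕ} {M : Type*} [TopologicalSpace M] [ChartedSpace (Cn n) M]

variable [MeasurableSpace M] [BorelSpace M]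

theorem IsPSHOn.measurableSet_shell {ψ : M → EReal} (hψ : IsPSHOn n ψ univ) (t T₂ : ℝ) :
    MeasurableSet (shell ψ t T₂) :=
  (hψ.isOpen_sublevel t).measurableSet.diff (hψ.isOpen_sublevel T₂).measurableSet

variable [SecondCountableTopology M]

theorem NForm.sqIntegral_mono (F : NForm n M) (w : M → ℝ≥0∞) {S S' : Set M} (h : S ⊆ S')
    (hS : MeasurableSet S) (hS' : MeasurableSet S') : F.sqIntegral w S ≤ F.sqIntegral w S' := by
  rw [F.sqIntegral_eq w hS, F.sqIntegral_eq w hS']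
  exact lintegral_mono_set h

theorem NForm.sqIntegral_congr {F G : NForm n M} (w : M → ℝ≥0∞) {S : Set M}
    (hS : MeasurableSet S) (h : ∀ x ∈ S, F x = G x) : F.sqIntegral w S = G.sqIntegral w S := by
  rw [F.sqIntegral_eq w hS, G.sqIntegral_eq w hS]
  refine setLIntegral_congr_fun hS fun x hx => ?_
  simp only [NForm.selectedCoeff, NForm.coeff_congr (h x hx)]

theorem NForm.sqIntegral_congr_weight (F : NForm n M) {w w' : M → ℝ≥0∞} {S : Set M}
    (hS : MeasurableSet S) (h : ∀ x ∈ S, w x = w' x) : F.sqIntegral w S = F.sqIntegral w' S := by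
  rw [F.sqIntegral_eq w hS, F.sqIntegral_eq w' hS]
  exact setLIntegral_congr_fun hS fun x hx => by simp only [h x hx]

theorem NForm.sqIntegral_sublevel_eq_add (F : NForm n M) (w : M → ℝ≥0∞) {ψ : M → EReal}
    (hψ : IsPSHOn n ψ univ) {s T₂ : ℝ} (hs : s ≤ T₂) :
    F.sqIntegral w (sublevel ψ s) =
      F.sqIntegral w (sublevel ψ T₂) + F.sqIntegral w (shell ψ s T₂) := by
  rw [F.sqIntegral_eq w (hψ.isOpen_sublevel s).measurableSet,
    F.sqIntegral_eq w (hψ.isOpen_sublevel T₂).measurableSet,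
    F.sqIntegral_eq w (hψ.measurableSet_shell s T₂), ← lintegral_union
    (hψ.measurableSet_shell s T₂) disjoint_sdiff_right, shell, union_sdiff_cancel (sublevel_anti hs)]

open Classical in
theorem NForm.sqIntegral_piecewise_zero (H : NForm n M) (w : M → ℝ≥0∞) {A S : Set M}
    (hA : MeasurableSet A) (hS : MeasurableSet S) :
    NForm.sqIntegral (A.piecewise H 0 : NForm n M) w S = H.sqIntegral w (A ∩ S) := by
  rw [NForm.sqIntegral_eq _ w hS, H.sqIntegral_eq w (hA.inter hS), ← setLIntegral_indicator hA]
  refine lintegral_congr fun x => ?_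
  by_cases hx : x ∈ A
  · rw [indicator_of_mem hx]
    simp only [NForm.selectedCoeff, NForm.coeff_congr (piecewise_eq_of_mem A H 0 hx)]
  · rw [indicator_of_notMem hx]
    have : NForm.selectedCoeff (A.piecewise H 0 : NForm n M) x = 0 :=
      NForm.coeff_congr (G := 0) (piecewise_eq_of_notMem A H 0 hx) _
    rw [this]
    simp

/-- A form which minimizes the weighted `L²` norm on the affine line through `F` and `H` satisfies
the Pythagorean identity. -/
theorem NForm.sqIntegral_eq_add_of_minimal {F H : NForm n M} {w : M → ℝ≥0∞} {Ω : Set M}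
    (hΩ : IsOpen Ω) (hw : AEMeasurable w (refMeasure n M)) (hF : F.HolomorphicOn Ω)
    (hH : H.HolomorphicOn Ω) (hF2 : F.sqIntegral w Ω < ⊤) (hH2 : H.sqIntegral w Ω < ⊤)
    (hmin : ∀ ε : ℝ, F.sqIntegral w Ω ≤ (F + (ε : ℂ) • (H - F) : NForm n M).sqIntegral w Ω) :
    H.sqIntegral w Ω = F.sqIntegral w Ω + (H - F : NForm n M).sqIntegral w Ω := by
  set ν := ((refMeasure n M).restrict Ω).withDensity fun x => 2 ^ n * w x with hν
  have hwm : AEMeasurable (fun x => 2 ^ n * w x) ((refMeasure n M).restrict Ω) :=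
    hw.restrict.const_mul _
  have hac : ν ≪ (refMeasure n M).restrict Ω := withDensity_absolutelyContinuous _ _
  have key : ∀ G : NForm n M, G.HolomorphicOn Ω →
      G.sqIntegral w Ω = ∫⁻ x, ‖G.selectedCoeff x‖ₑ ^ 2 ∂ν := by
    intro G hG
    rw [G.sqIntegral_eq w hΩ.measurableSet, hν, lintegral_withDensity_eq_lintegral_mul₀ hwm
      ((hG.aemeasurable_selectedCoeff hΩ).enorm.pow_const 2)]
    refine lintegral_congr fun x => ?_
    simp only [Pi.mul_apply]
    ring
  have hD := hH.sub hF
  rw [key F hF, key H hH, key _ hD]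
  rw [key F hF] at hF2 hmin
  rw [key H hH] at hH2
  refine lintegral_sq_eq_add_of_minimal
    ((hF.aemeasurable_selectedCoeff hΩ).mono_ac hac).aestronglyMeasurable
    ((hH.aemeasurable_selectedCoeff hΩ).mono_ac hac).aestronglyMeasurable hF2 hH2 fun ε => ?_
  have h := hmin ε
  rwa [key _ (hF.add_smul hD ε)] at h

/-- The image under `-ψ` of the measure `|F|² w` on the shell `{-T₂ ≤ ψ < -t}`. -/
noncomputable def levelMeasure (F : NForm n M) (w : M → ℝ≥0∞) (ψ : M → EReal) (t T₂ : ℝ) :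
    Measure ℝ :=
  (((refMeasure n M).restrict (shell ψ t T₂)).withDensity
    fun x => 2 ^ n * ‖F.selectedCoeff x‖ₑ ^ 2 * w x).map fun x => (-(ψ x)).toReal

section

variable {F : NForm n M} {w : M → ℝ≥0∞} {ψ : M → EReal} {t T₂ : ℝ}

/-- The intervals ending at `T₂` correspond to shells, whose integrals are differences of integrals
over sublevel sets. -/
theorem levelMeasure_Ioc (hψ : IsPSHOn n ψ univ) {s : ℝ} (hs : s ∈ Icc t T₂) :
    levelMeasure F w ψ t T₂ (Ioc s T₂) = F.sqIntegral w (shell ψ s T₂) := by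
  have hσ : Measurable fun x => (-(ψ x)).toReal := hψ.measurable.neg.ereal_toReal
  rw [levelMeasure, Measure.map_apply hσ measurableSet_Ioc,
    withDensity_apply _ (hσ measurableSet_Ioc), Measure.restrict_restrict (hσ measurableSet_Ioc),
    F.sqIntegral_eq w (hψ.measurableSet_shell s T₂)]
  have hset : (fun x => (-(ψ x)).toReal) ⁻¹' Ioc s T₂ ∩ shell ψ t T₂ = shell ψ s T₂ := by
    ext x
    simp only [mem_inter_iff, mem_preimage, mem_shell_iff]
    constructor
    · rintro ⟨h1, r, hr, hx⟩
      rw [toReal_neg_of_eq hx] at h1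
      exact ⟨r, h1, hx⟩
    · rintro ⟨r, hr, hx⟩
      rw [toReal_neg_of_eq hx]
      exact ⟨hr, r, ⟨hs.1.trans_lt hr.1, hr.2⟩, hx⟩
  rw [hset]

/-- Functions of the level of `ψ` can be multiplied into the weight. -/
theorem setLIntegral_levelMeasure (hψ : IsPSHOn n ψ univ)
    (hw : AEMeasurable w (refMeasure n M))
    (hF : F.HolomorphicOn (sublevel ψ t)) {g : ℝ → ℝ≥0∞} (hg : Measurable g) :
    ∫⁻ s in Ioc t T₂, g s ∂(levelMeasure F w ψ t T₂) =
      F.sqIntegral (fun x => w x * g (-(ψ x)).toReal) (shell ψ t T₂) := by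
  have hσ : Measurable fun x => (-(ψ x)).toReal := hψ.measurable.neg.ereal_toReal
  have hSm := hψ.measurableSet_shell t T₂
  have hρ : AEMeasurable (fun x => 2 ^ n * ‖F.selectedCoeff x‖ₑ ^ 2 * w x)
      ((refMeasure n M).restrict (shell ψ t T₂)) :=
    ((((hF.aemeasurable_selectedCoeff (hψ.isOpen_sublevel t)).mono_measure
      (Measure.restrict_mono sdiff_subset le_rfl)).enorm.pow_const 2).const_mul _).mul hw.restrict
  rw [levelMeasure, setLIntegral_map measurableSet_Ioc hg hσ]
  rw [Measure.restrict_eq_self_of_ae_mem]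
  · refine (lintegral_withDensity_eq_lintegral_mul₀ hρ (hg.comp hσ).aemeasurable).trans ?_
    rw [F.sqIntegral_eq _ hSm]
    refine lintegral_congr fun x => ?_
    simp only [Pi.mul_apply, Function.comp_apply]
    ring
  · refine (withDensity_absolutelyContinuous _ _).ae_le ?_
    filter_upwards [ae_restrict_mem hSm] with x hx
    obtain ⟨s, hs, hx⟩ := mem_shell_iff.1 hx
    rw [mem_preimage, toReal_neg_of_eq hx]
    exact hs

end

end Shell

/-! ### Transfer of minimality and linearity between gains -/

section Transfer

theorem sublevel_eq_iUnion {M : Type*} (ψ : M → EReal) (t : ℝ) {u : ℕ → ℝ} (hu : ∀ m, t ≤ u m)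
    (hlim : Tendsto u atTop (𝓝 t)) : sublevel ψ t = ⋃ m, sublevel ψ (u m) := by
  refine Subset.antisymm (fun x hx => ?_) (iUnion_subset fun m => sublevel_anti (hu m))
  obtain ⟨q, hq1, hq2⟩ := EReal.lt_iff_exists_real_btwn.1 hx
  have hq : t < -q := by
    have : q < -t := by exact_mod_cast hq2
    linarith
  obtain ⟨m, hm⟩ := (hlim.eventually (gt_mem_nhds hq)).exists
  exact mem_iUnion.2 ⟨m, hq1.trans (EReal.coe_lt_coe (by linarith))⟩

theorem sublevel_inter_sublevel {M : Type*} {ψ ψ' : M → EReal} {T₁ T₂ : ℝ}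
    (h1' : sublevel ψ T₂ ⊆ sublevel ψ' T₂)
    (h2 : ∀ x, ((-T₂ : ℝ) : EReal) ≤ ψ x → ψ x < ((-T₁ : ℝ) : EReal) → ψ' x = ψ x)
    {s : ℝ} (hs : s ∈ Icc T₁ T₂) : sublevel ψ T₁ ∩ sublevel ψ' s = sublevel ψ s := by
  ext x
  constructor
  · rintro ⟨hx1, hx2⟩
    rcases le_or_gt ((-T₂ : ℝ) : EReal) (ψ x) with h | h
    · change ψ x < _
      rw [← h2 x h hx1]
      exact hx2
    · exact sublevel_anti hs.2 h
  · intro hx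
    have hx1 : x ∈ sublevel ψ T₁ := sublevel_anti hs.1 hx
    refine ⟨hx1, ?_⟩
    rcases le_or_gt ((-T₂ : ℝ) : EReal) (ψ x) with h | h
    · change ψ' x < _
      rw [h2 x h hx1]
      exact hx
    · exact sublevel_anti hs.2 (h1' h)

variable {n : ℕ} {M : Type*} [TopologicalSpace M] [ChartedSpace (Cn n) M]
  {ψ ψ' φ φ' : M → EReal} {T₁ T₂ : ℝ}

/-- On the common shell the two weights differ by the quotient of the gains, a function of the
level of `ψ`. -/
theorem weight_eq_mul_on_shell {Z : Set M} {T : EReal} {c c' : ℝ → ℝ} {t : ℝ}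
    (hc' : IsGain Z T φ' ψ' c') (hTt : T ≤ (t : EReal)) (htT : T₁ ≤ t)
    (h2 : ∀ x, ((-T₂ : ℝ) : EReal) ≤ ψ x → ψ x < ((-T₁ : ℝ) : EReal) → ψ' x = ψ x ∧ φ' x = φ x)
    {x : M} (hx : x ∈ shell ψ t T₂) :
    weight φ ψ c x = weight φ' ψ' c' x *
      (gainDensity T c (-(ψ x)).toReal / gainDensity T c' (-(ψ x)).toReal) := by
  obtain ⟨s, hs, hxs⟩ := mem_shell_iff.1 hx
  obtain ⟨hψx, hφx⟩ := h2 x (not_lt.1 hx.2) (sublevel_anti htT hx.1)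
  have hTs : T < (s : EReal) := hTt.trans_lt (by exact_mod_cast hs.1)
  have hpos := hc'.pos s hTs
  have he := Real.exp_pos (-s)
  rw [weight, weight, hψx, hφx, toReal_neg_of_eq hxs, gainDensity_of_lt hTs, gainDensity_of_lt hTs,
    ← ENNReal.ofReal_div_of_pos (mul_pos hpos he), mul_assoc, ← ENNReal.ofReal_mul hpos.le]
  congr 2
  field_simp

variable [SecondCountableTopology M]

/-- Since `{ψ < -T₁}` is relatively closed in `{ψ' < -T₁}`, forms on `{ψ < -s}` extend by zero to
`{ψ' < -s}`, so that they compete in the minimum problem for `ψ'`. -/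
theorem minimalIntegral_le_sqIntegral [MeasurableSpace M] [BorelSpace M]
    (hψ : IsPSHOn n ψ univ) (hψ' : IsPSHOn n ψ' univ)
    (hT : T₁ < T₂) (h1' : sublevel ψ T₂ ⊆ sublevel ψ' T₂)
    (h2 : ∀ x, ((-T₂ : ℝ) : EReal) ≤ ψ x → ψ x < ((-T₁ : ℝ) : EReal) → ψ' x = ψ x)
    {s : ℝ} (hs : s ∈ Icc T₁ T₂) {f : NForm n M} {Z₀ : Set M}
    {𝓕 : (z : M) → Ideal (HoloGerm n z)} {c : ℝ → ℝ} {H : NForm n M}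
    (hH : Admissible f Z₀ 𝓕 ψ s H) :
    minimalIntegral f Z₀ 𝓕 φ' ψ' c s ≤ H.sqIntegral (weight φ' ψ' c) (sublevel ψ s) := by
  classical
  have hset := sublevel_inter_sublevel h1' h2 hs
  have hAo := hψ.isOpen_sublevel T₁
  have hΩo := hψ'.isOpen_sublevel s
  have hadm : Admissible f Z₀ 𝓕 ψ' s ((sublevel ψ T₁).piecewise H 0 : NForm n M) := by
    refine ⟨NForm.HolomorphicOn.piecewise_zero hAo hΩo (fun x hx hxA =>
      sublevel_relatively_closed hψ hψ' hT h2 (sublevel_anti hs.1 hx) hxA) (hset ▸ hH.1),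
      fun z hz => ?_⟩
    obtain ⟨hzs, γ, hγ, hγe⟩ := hH.2 z hz
    rw [← hset] at hzs
    refine ⟨hzs.2, γ, hγ, hγe.trans (Germ.coe_eq.2 ?_)⟩
    filter_upwards [hAo.mem_nhds hzs.1] with x hx
    refine NForm.coeff_congr ?_ _
    change H x - f x = (sublevel ψ T₁).piecewise H 0 x - f x
    rw [piecewise_eq_of_mem _ _ _ hx]
  refine (iInf₂_le _ hadm).trans (le_of_eq ?_)
  rw [energy, NForm.sqIntegral_piecewise_zero H _ hAo.measurableSet hΩo.measurableSet, hset]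

variable [MeasurableSpace M] [BorelSpace M]

/-- If `F` has minimal norm on every sublevel set `{ψ < -s}`, `t ≤ s ≤ T₂`, then the Pythagorean
identity holds level by level, so that minimality on the shell persists when the weight is multiplied
by a function of the level. -/
theorem NForm.sqIntegral_shell_le_of_minimal {F H : NForm n M} {w : M → ℝ≥0∞} {t : ℝ}
    (ht : t ≤ T₂) (hψ : IsPSHOn n ψ univ) (hw : AEMeasurable w (refMeasure n M))
    (hF : F.HolomorphicOn (sublevel ψ t)) (hH : H.HolomorphicOn (sublevel ψ t))
    (hF2 : F.sqIntegral w (sublevel ψ t) < ⊤) (hH2 : H.sqIntegral w (sublevel ψ t) < ⊤)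
    (hmin : ∀ s ∈ Icc t T₂, ∀ ε : ℝ, F.sqIntegral w (sublevel ψ s) ≤
      (F + (ε : ℂ) • (H - F) : NForm n M).sqIntegral w (sublevel ψ s))
    {g : ℝ → ℝ≥0∞} (hg : Measurable g) :
    F.sqIntegral (fun x => w x * g (-(ψ x)).toReal) (shell ψ t T₂) ≤
      H.sqIntegral (fun x => w x * g (-(ψ x)).toReal) (shell ψ t T₂) := by
  have hD := hH.sub hF
  have hmeas := fun s => (hψ.isOpen_sublevel s).measurableSet
  have hfin : ∀ s ∈ Icc t T₂, ∀ G : NForm n M, G.sqIntegral w (sublevel ψ t) < ⊤ →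
      G.sqIntegral w (sublevel ψ s) < ⊤ := fun s hs G hG =>
    (G.sqIntegral_mono w (sublevel_anti hs.1) (hmeas s) (hmeas t)).trans_lt hG
  have hpyth : ∀ s ∈ Icc t T₂, H.sqIntegral w (sublevel ψ s) =
      F.sqIntegral w (sublevel ψ s) + (H - F : NForm n M).sqIntegral w (sublevel ψ s) :=
    fun s hs => NForm.sqIntegral_eq_add_of_minimal (hψ.isOpen_sublevel s) hw
      (hF.mono (sublevel_anti hs.1)) (hH.mono (sublevel_anti hs.1)) (hfin s hs F hF2)
      (hfin s hs H hH2) (hmin s hs)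
  have hshell : ∀ s ∈ Icc t T₂, H.sqIntegral w (shell ψ s T₂) =
      F.sqIntegral w (shell ψ s T₂) + (H - F : NForm n M).sqIntegral w (shell ψ s T₂) := by
    intro s hs
    have hT := hpyth T₂ ⟨ht, le_rfl⟩
    have h := hpyth s hs
    rw [H.sqIntegral_sublevel_eq_add w hψ hs.2, F.sqIntegral_sublevel_eq_add w hψ hs.2,
      (H - F).sqIntegral_sublevel_eq_add w hψ hs.2, add_add_add_comm, ← hT] at h
    exact (ENNReal.add_right_inj (hfin T₂ ⟨ht, le_rfl⟩ H hH2).ne).1 h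
  have hα : (levelMeasure H w ψ t T₂).restrict (Ioc t T₂) =
      (levelMeasure F w ψ t T₂ + levelMeasure (H - F) w ψ t T₂).restrict (Ioc t T₂) := by
    refine restrict_Ioc_eq_of_forall ?_ fun s hs => ?_
    · rw [levelMeasure_Ioc hψ ⟨le_rfl, ht⟩]
      refine ((H.sqIntegral_mono w sdiff_subset (hψ.measurableSet_shell t T₂)
        (hmeas t)).trans_lt hH2).ne
    · rw [Measure.add_apply, levelMeasure_Ioc hψ hs, levelMeasure_Ioc hψ hs,
        levelMeasure_Ioc hψ hs, hshell s hs]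
  rw [← setLIntegral_levelMeasure hψ hw hF hg, ← setLIntegral_levelMeasure hψ hw hH hg, hα,
    Measure.restrict_add, lintegral_add_measure]
  exact le_self_add

/-- If the density `|F|² w` is distributed over the levels of `ψ` as `k D(s) ds`, then so it is after
multiplication of both densities by a function of the level. -/
theorem NForm.sqIntegral_shell_eq_of_distribution {F : NForm n M} {w : M → ℝ≥0∞} {t : ℝ}
    (ht : t ≤ T₂) (hψ : IsPSHOn n ψ univ) (hw : AEMeasurable w (refMeasure n M))
    (hF : F.HolomorphicOn (sublevel ψ t)) (hF2 : F.sqIntegral w (sublevel ψ t) < ⊤)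
    {k : ℝ≥0∞} {D : ℝ → ℝ≥0∞} (hD : Measurable D)
    (h : ∀ s ∈ Icc t T₂, F.sqIntegral w (shell ψ s T₂) = k * ∫⁻ r in Ioc s T₂, D r)
    {g : ℝ → ℝ≥0∞} (hg : Measurable g) :
    F.sqIntegral (fun x => w x * g (-(ψ x)).toReal) (shell ψ t T₂) =
      k * ∫⁻ r in Ioc t T₂, D r * g r := by
  have hα : (levelMeasure F w ψ t T₂).restrict (Ioc t T₂) =
      (k • volume.withDensity D).restrict (Ioc t T₂) := by
    refine restrict_Ioc_eq_of_forall ?_ fun s hs => ?_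
    · rw [levelMeasure_Ioc hψ ⟨le_rfl, ht⟩]
      exact ((F.sqIntegral_mono w sdiff_subset (hψ.measurableSet_shell t T₂)
        (hψ.isOpen_sublevel t).measurableSet).trans_lt hF2).ne
    · rw [levelMeasure_Ioc hψ hs, h s hs, Measure.smul_apply,
        withDensity_apply _ measurableSet_Ioc, smul_eq_mul]
  rw [← setLIntegral_levelMeasure hψ hw hF hg, hα, Measure.restrict_smul, lintegral_smul_measure,
    restrict_withDensity measurableSet_Ioc, lintegral_withDensity_eq_lintegral_mul _ hD hg,
    smul_eq_mul]
  rfl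

end Transfer

end MinimalL2

/-! ### Linearity of the minimal integrals of the first datum -/

theorem mainTheorem6 {n : ℕ} {M : Type*} [TopologicalSpace M] [T2Space M]
    [SecondCountableTopology M] [ChartedSpace (Cn n) M] [IsManifold 𝓘(ℂ, Cn n) ω M]
    (X Z : Set M) (hA : ConditionA n X Z)
    (T : EReal) (T₁ T₂ : ℝ) (hT₁ : T ≤ (T₁ : EReal)) (hT₁₂ : T₁ < T₂)
    (φ ψ φ' ψ' : M → EReal)
    (hψ : IsPSHOn n ψ univ) (hψT : ∀ x, ψ x < -T)
    (hψ' : IsPSHOn n ψ' univ) (hψT' : ∀ x, ψ' x < -T)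
    (hφ : LebesgueMeasurable n φ) (hφψ : SumIsPSH n φ ψ)
    (hφ' : LebesgueMeasurable n φ') (hφψ' : SumIsPSH n φ' ψ')
    (Z₀ Z₀' : Set M)
    (hZ₀ : (Z₀ ∩ cosupport n (fun x => φ x + ψ x)).Nonempty)
    (hZ₀' : (Z₀' ∩ cosupport n (fun x => φ' x + ψ' x)).Nonempty)
    (U : Set M) (hU : IsOpen U) (hZ₀U : Z₀ ⊆ U)
    (f : NForm n M) (hf : f.HolomorphicOn U)
    (𝓕 𝓕' : (z : M) → Ideal (HoloGerm n z))
    (h𝓕 : ∀ z ∈ Z₀, multiplierIdeal n (fun x => φ x + ψ x) z ⊆ (𝓕 z : Set (HoloGerm n z)))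
    (h𝓕' : ∀ z ∈ Z₀', multiplierIdeal n (fun x => φ' x + ψ' x) z ⊆ (𝓕' z : Set (HoloGerm n z)))
    (c c' : ℝ → ℝ)
    (hc : IsGain Z T φ ψ c) (hcT₂ : gainTail c T₂ < ⊤)
    (hc' : IsGain Z T φ' ψ' c') (hcT₂' : gainTail c' T₂ < ⊤)
    -- (1) sublevel sets
    (h1 : ∀ x, ψ x < ((-T₁ : ℝ) : EReal) → ψ' x < ((-T₁ : ℝ) : EReal))
    (h1' : ∀ x, ψ x < ((-T₂ : ℝ) : EReal) → ψ' x < ((-T₂ : ℝ) : EReal))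
    -- (2) the data agree on the shell
    (h2 : ∀ x, ((-T₂ : ℝ) : EReal) ≤ ψ x → ψ x < ((-T₁ : ℝ) : EReal) →
      ψ' x = ψ x ∧ φ' x = φ x)
    -- (3) ideals
    (h3 : Z₀' = Z₀)
    (h3' : ∀ z ∈ Z₀, multiplierIdeal n (fun x => φ' x + ψ' x) z ⊆
      multiplierIdeal n (fun x => φ x + ψ x) z)
    (h3'' : ∀ z ∈ Z₀, 𝓕 z ≤ 𝓕' z)
    -- (4) inclusion of the Hilbert spaces, as forms on the sublevel set of `ψ`
    (h4 : ∀ t ∈ Icc T₁ T₂, ∀ F ∈ H2 f Z₀ 𝓕 φ ψ c t,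
      ∃ F' ∈ H2 f Z₀' 𝓕' φ' ψ' c' t, ∀ x ∈ sublevel ψ t, F' x = F x)
    -- linearity for the second datum
    (hlin : LinearBetween (minimalIntegral f Z₀' 𝓕' φ' ψ' c') (gainTail c') T₁ T₂)
    -- the extremal form of the second datum on the whole interval
    (F : NForm n M) (hF : Admissible f Z₀' 𝓕' ψ' T₁ F)
    (hFmin : ∀ t ∈ Icc T₁ T₂, energy φ' ψ' c' t F = minimalIntegral f Z₀' 𝓕' φ' ψ' c' t)
    -- it also minimizes the (finite) minimal integral of the first datum at `T₂`
    (hFadm : Admissible f Z₀ 𝓕 ψ T₂ F)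
    (hFmin₂ : energy φ ψ c T₂ F = minimalIntegral f Z₀ 𝓕 φ ψ c T₂)
    (hfin : minimalIntegral f Z₀ 𝓕 φ ψ c T₂ < ⊤) :
    LinearBetween (minimalIntegral f Z₀ 𝓕 φ ψ c) (gainTail c) T₁ T₂ := by
  borelize M
  subst h3
  obtain ⟨a, b, hab⟩ := hlin
  have h2ψ : ∀ x, ((-T₂ : ℝ) : EReal) ≤ ψ x → ψ x < ((-T₁ : ℝ) : EReal) → ψ' x = ψ x :=
    fun x hx hx' => (h2 x hx hx').1
  have hw' : AEMeasurable (weight φ' ψ' c') (refMeasure n M) :=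
    hc'.aemeasurable_weight hφ' hψ' hψT'
  have hmeas := fun s => (hψ.isOpen_sublevel s).measurableSet
  have hsub : ∀ s ∈ Icc T₁ T₂, sublevel ψ s ⊆ sublevel ψ' s := fun s hs => by
    rw [← sublevel_inter_sublevel h1' h2ψ hs]; exact inter_subset_right
  have hZT₂ : Z₀' ⊆ sublevel ψ T₂ := fun z hz => (hFadm.2 z hz).1
  have hFhol : F.HolomorphicOn (sublevel ψ T₁) := hF.1.mono (hsub T₁ ⟨le_rfl, hT₁₂.le⟩)
  have hFs : ∀ s ∈ Icc T₁ T₂, Admissible f Z₀' 𝓕 ψ s F := fun s hs =>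
    ⟨hFhol.mono (sublevel_anti hs.1), fun z hz =>
      ⟨sublevel_anti hs.2 (hZT₂ hz), (hFadm.2 z hz).2⟩⟩
  -- an admissible form for the first datum satisfies the condition on germs of the second
  have hweak : ∀ s (H : NForm n M), Admissible f Z₀' 𝓕 ψ s H → Admissible f Z₀' 𝓕' ψ s H := by
    rintro s H ⟨h, h'⟩
    refine ⟨h, fun z hz => ?_⟩
    obtain ⟨hzs, γ, hγ, hγe⟩ := h' z hz
    exact ⟨hzs, γ, h3'' z hz hγ, hγe⟩
  have hcomp : ∀ s ∈ Icc T₁ T₂, ∀ H : NForm n M, Admissible f Z₀' 𝓕' ψ s H →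
      minimalIntegral f Z₀' 𝓕' φ' ψ' c' s ≤ H.sqIntegral (weight φ' ψ' c') (sublevel ψ s) :=
    fun s hs H hH => minimalIntegral_le_sqIntegral hψ hψ' hT₁₂ h1' h2ψ hs hH
  have hFeq : ∀ s ∈ Icc T₁ T₂, F.sqIntegral (weight φ' ψ' c') (sublevel ψ s) =
      minimalIntegral f Z₀' 𝓕' φ' ψ' c' s := fun s hs =>
    le_antisymm ((F.sqIntegral_mono _ (hsub s hs) (hmeas s)
      (hψ'.isOpen_sublevel s).measurableSet).trans_eq (hFmin s hs))
      (hcomp s hs F (hweak s F (hFs s hs)))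
  have hlt : ∀ t, T₁ < t → T < (t : EReal) := fun t ht => hT₁.trans_lt (EReal.coe_lt_coe ht)
  have htail : ∀ t ∈ Ioc T₁ T₂, gainTail c' t = ENNReal.ofReal (gainTail c' t).toReal :=
    fun t ht => (ENNReal.ofReal_toReal
      (hc'.gainTail_lt_top (hlt t ht.1) ht.2 hcT₂').ne).symm
  have hG' : ∀ t ∈ Ioc T₁ T₂, minimalIntegral f Z₀' 𝓕' φ' ψ' c' t ≠ ⊤ ∧
      (minimalIntegral f Z₀' 𝓕' φ' ψ' c' t).toReal = a * (gainTail c' t).toReal + b :=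
    fun t ht => hab t ⟨ht.1.le, ht.2⟩ _ ENNReal.toReal_nonneg (htail t ht)
  have hT₂mem : T₂ ∈ Ioc T₁ T₂ := ⟨hT₁₂, le_rfl⟩
  -- linearity for the second datum gives the distribution of `|F|²` over the levels of `ψ`
  have hdist : ∀ s ∈ Ioc T₁ T₂, F.sqIntegral (weight φ' ψ' c') (shell ψ s T₂) =
      ENNReal.ofReal a * ∫⁻ r in Ioc s T₂, gainDensity T c' r := by
    intro s hs
    have hadd := F.sqIntegral_sublevel_eq_add (weight φ' ψ' c') hψ hs.2
    rw [hFeq s ⟨hs.1.le, hs.2⟩, hFeq T₂ ⟨hT₁₂.le, le_rfl⟩] at hadd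
    have htl := gainTail_eq_add (c := c') (hlt s hs.1).le hs.2
    set A := F.sqIntegral (weight φ' ψ' c') (shell ψ s T₂)
    set I := ∫⁻ r in Ioc s T₂, gainDensity T c' r
    have hA : A ≠ ⊤ := fun h => (hG' s hs).1 (by rw [hadd, h, add_top])
    have hI : I ≠ ⊤ := fun h =>
      (hc'.gainTail_lt_top (hlt s hs.1) hs.2 hcT₂').ne (by rw [htl, h, add_top])
    have hreal : A.toReal = a * I.toReal := by
      have e1 := (hG' s hs).2
      have e2 := (hG' T₂ hT₂mem).2
      rw [hadd, htl, ENNReal.toReal_add (hG' T₂ hT₂mem).1 hA,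
        ENNReal.toReal_add hcT₂'.ne hI, e2] at e1
      linarith
    rw [← ENNReal.ofReal_toReal hA, hreal, ENNReal.ofReal_mul' ENNReal.toReal_nonneg,
      ENNReal.ofReal_toReal hI]
  -- the quotient of the gains, by which the weights differ on the shell
  set g : ℝ → ℝ≥0∞ := fun s => gainDensity T c s / gainDensity T c' s with hg
  have hgm : Measurable g := hc.measurable_gainDensity.div hc'.measurable_gainDensity
  have hgain : ∀ t, T₁ ≤ t → ∀ H : NForm n M, H.sqIntegral (weight φ ψ c) (shell ψ t T₂) =
      H.sqIntegral (fun x => weight φ' ψ' c' x * g (-(ψ x)).toReal) (shell ψ t T₂) :=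
    fun t ht H => H.sqIntegral_congr_weight (hψ.measurableSet_shell t T₂) fun x hx =>
      weight_eq_mul_on_shell hc' (hT₁.trans (EReal.coe_le_coe ht)) ht h2 hx
  have hfinF : ∀ t ∈ Ioc T₁ T₂, F.sqIntegral (weight φ' ψ' c') (sublevel ψ t) < ⊤ := fun t ht => by
    rw [hFeq t ⟨ht.1.le, ht.2⟩]; exact (hG' t ht).1.lt_top
  have henergyF : ∀ t ∈ Ioc T₁ T₂, energy φ ψ c t F = minimalIntegral f Z₀' 𝓕 φ ψ c T₂ +
      ENNReal.ofReal a * ∫⁻ r in Ioc t T₂, gainDensity T c r := by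
    intro t ht
    rw [← hFmin₂, energy, energy, F.sqIntegral_sublevel_eq_add _ hψ ht.2, hgain t ht.1.le,
      F.sqIntegral_shell_eq_of_distribution ht.2 hψ hw' (hFhol.mono (sublevel_anti ht.1.le))
        (hfinF t ht) hc'.measurable_gainDensity
        (fun s hs => hdist s ⟨ht.1.trans_le hs.1, hs.2⟩) hgm]
    congr 2
    refine setLIntegral_congr_fun measurableSet_Ioc fun s hs => ?_
    have hTs := hlt s (ht.1.trans hs.1)
    exact ENNReal.mul_div_cancel (hc'.gainDensity_ne_zero hTs) (gainDensity_ne_top hTs)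
  have hGt : ∀ t ∈ Ioc T₁ T₂, minimalIntegral f Z₀' 𝓕 φ ψ c t =
      minimalIntegral f Z₀' 𝓕 φ ψ c T₂ +
        ENNReal.ofReal a * ∫⁻ r in Ioc t T₂, gainDensity T c r := by
    intro t ht
    have htI : t ∈ Icc T₁ T₂ := ⟨ht.1.le, ht.2⟩
    rw [← henergyF t ht]
    refine le_antisymm (iInf₂_le _ (hFs t htI)) (le_iInf₂ fun H hH => ?_)
    rcases eq_or_ne (energy φ ψ c t H) ⊤ with htop | htop
    · rw [htop]; exact le_top
    obtain ⟨H', hH', hHH'⟩ := h4 t htI H ⟨hH, htop.lt_top⟩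
    have hH2 : H.sqIntegral (weight φ' ψ' c') (sublevel ψ t) < ⊤ := by
      rw [← NForm.sqIntegral_congr _ (hmeas t) hHH']
      exact (H'.sqIntegral_mono _ (hsub t htI) (hmeas t)
        (hψ'.isOpen_sublevel t).measurableSet).trans_lt hH'.2
    have hHs : ∀ s ∈ Icc t T₂, Admissible f Z₀' 𝓕 ψ s H := fun s hs =>
      hH.mono (sublevel_anti hs.1) (hZT₂.trans (sublevel_anti hs.2))
    rw [energy, energy, F.sqIntegral_sublevel_eq_add _ hψ ht.2,
      H.sqIntegral_sublevel_eq_add _ hψ ht.2, hgain t ht.1.le, hgain t ht.1.le]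
    refine add_le_add ?_ (NForm.sqIntegral_shell_le_of_minimal ht.2 hψ hw' (hFs t htI).1 hH.1
      (hfinF t ht) hH2 (fun s hs ε => ?_) hgm)
    · exact hFmin₂.trans_le (iInf₂_le _ (hHs T₂ ⟨ht.2, le_rfl⟩))
    · have hsI : s ∈ Icc T₁ T₂ := ⟨ht.1.le.trans hs.1, hs.2⟩
      rw [hFeq s hsI]
      exact hcomp s hsI _ (hweak s _ ((hFs s hsI).line (hHs s hs) ε))
  -- the endpoint `T₁`, where `c'(t) e^{-t}` need not be integrable, is reached by monotone limits
  have hGT₁ : minimalIntegral f Z₀' 𝓕 φ ψ c T₁ = minimalIntegral f Z₀' 𝓕 φ ψ c T₂ +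
      ENNReal.ofReal a * ∫⁻ r in Ioc T₁ T₂, gainDensity T c r := by
    obtain ⟨u, huanti, humem, hulim⟩ := exists_seq_strictAnti_tendsto' hT₁₂
    have hu : ∀ m, u m ∈ Ioc T₁ T₂ := fun m => ⟨(humem m).1, (humem m).2.le⟩
    have hI : ∫⁻ r in Ioc T₁ T₂, gainDensity T c r =
        ⨆ m, ∫⁻ r in Ioc (u m) T₂, gainDensity T c r := by
      rw [← setLIntegral_iUnion_of_directed]
      · congr 2
        refine Subset.antisymm (fun r hr => ?_) (iUnion_subset fun m =>
          Ioc_subset_Ioc_left (humem m).1.le)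
        obtain ⟨m, hm⟩ := (hulim.eventually (gt_mem_nhds hr.1)).exists
        exact mem_iUnion.2 ⟨m, hm, hr.2⟩
      · exact directed_of_isDirected_le fun i j hij =>
          Ioc_subset_Ioc_left (huanti.antitone hij)
    have hsup : minimalIntegral f Z₀' 𝓕 φ ψ c T₂ +
        ENNReal.ofReal a * ∫⁻ r in Ioc T₁ T₂, gainDensity T c r =
        ⨆ m, (minimalIntegral f Z₀' 𝓕 φ ψ c T₂ +
          ENNReal.ofReal a * ∫⁻ r in Ioc (u m) T₂, gainDensity T c r) := by
      rw [hI, ENNReal.mul_iSup, ENNReal.add_iSup]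
    rw [hsup]
    refine le_antisymm ?_ (iSup_le fun m => ?_)
    · refine (iInf₂_le _ (hFs T₁ ⟨le_rfl, hT₁₂.le⟩)).trans (le_of_eq ?_)
      rw [energy, F.sqIntegral_eq _ (hmeas T₁),
        sublevel_eq_iUnion ψ T₁ (fun m => (humem m).1.le) hulim, setLIntegral_iUnion_of_directed]
      · refine iSup_congr fun m => ?_
        rw [← henergyF _ (hu m), energy, F.sqIntegral_eq _ (hmeas _)]
      · exact directed_of_isDirected_le fun i j hij => sublevel_anti (huanti.antitone hij)
    · rw [← hGt _ (hu m)]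
      refine le_iInf₂ fun H hH => (iInf₂_le H (hH.mono (sublevel_anti (humem m).1.le)
        (hZT₂.trans (sublevel_anti (humem m).2.le)))).trans ?_
      exact H.sqIntegral_mono _ (sublevel_anti (humem m).1.le) (hmeas _) (hmeas _)
  refine ⟨(ENNReal.ofReal a).toReal, (minimalIntegral f Z₀' 𝓕 φ ψ c T₂).toReal -
    (ENNReal.ofReal a).toReal * (gainTail c T₂).toReal, fun t ht r hr hrt => ?_⟩
  have hGt' : minimalIntegral f Z₀' 𝓕 φ ψ c t = minimalIntegral f Z₀' 𝓕 φ ψ c T₂ +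
      ENNReal.ofReal a * ∫⁻ r in Ioc t T₂, gainDensity T c r := by
    rcases ht.1.eq_or_lt with rfl | h
    · exact hGT₁
    · exact hGt t ⟨h, ht.2⟩
  have htl := gainTail_eq_add (c := c) (hT₁.trans (EReal.coe_le_coe ht.1)) ht.2
  rw [hGt']
  set I := ∫⁻ r in Ioc t T₂, gainDensity T c r
  rw [hrt] at htl
  have hI : I ≠ ⊤ := fun h => ENNReal.ofReal_ne_top (htl.trans (by rw [h, add_top]))
  have hr' : r = (gainTail c T₂).toReal + I.toReal := by
    rw [← ENNReal.toReal_add hcT₂.ne hI, ← htl, ENNReal.toReal_ofReal hr]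
  have hmul := ENNReal.mul_ne_top (ENNReal.ofReal_ne_top (r := a)) hI
  refine ⟨ENNReal.add_ne_top.2 ⟨hfin.ne, hmul⟩, ?_⟩
  rw [ENNReal.toReal_add hfin.ne hmul, ENNReal.toReal_mul, hr']
  ring
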